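/- Let $N,d\ge 1$ be integers, let $V_0,\dots,V_d\in C_b^\infty(\mathbb R^N;\mathbb R^N)$ (smooth maps that are bounded together with all their derivatives), regarded as vector fields acting on functions by $Vf=\sum_j V^j\,\partial f/\partial x_j$, and put $\|V\|_{C^n}=\sum_{i=0}^n\sup_x\|V^{(i)}(x)\|$, where $V^{(i)}$ is the $i$-th total differential with its operator norm. For $W\in C_b^\infty(\mathbb R^N;\mathbb R^N)$ let $\exp(W)(x)$ be the value at time $1$ of the solution of $dz_t/dt=W(z_t)$, $z_0=x$. A map $g$ from $C_b^\infty(\mathbb R^N;\mathbb R^N)$ to the set of all maps $\mathbb R^N\to\mathbb R^N$ is an integration scheme of order $m$, $g\in\mathcal{IS}(m)$, if there is a constant $C>0$ such that $\sup_x|g(W)(x)-\exp(W)(x)|\le C\|W\|_{C^{m+1}}^{m+1}$ for all $W\in C_b^\infty(\mathbb R^N;\mathbb R^N)$. Let $A=\{v_0,\dots,v_d\}$ be an alphabet, $A^*$ the set of words, and for $w=v_{i_1}\cdots v_{i_n}$ put $\|w\|=n+\#\{k: i_k=0\}$. On the algebra $\mathbb R\langle\langle A\rangle\rangle$ of non-commutative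 formal series $P=\sum_w (P,w)w$, with the product topology and its Borel $\sigma$-algebra, let $j_m P=\sum_{\|w\|\le m}(P,w)w$ and $\Psi_sP=\sum_w s^{\|w\|/2}(P,w)w$; for polynomials $P$ let $\|P\|_2=(\sum_w (P,w)^2)^{1/2}$. Lie polynomials form the smallest linear subspace that contains $A$ and is closed under $[P,Q]=PQ-QP$; Lie series, forming the set $\mathcal L_{\mathbb R}((A))$, are the series all of whose homogeneous components (with respect to $\|\cdot\|$) are Lie polynomials. With $\exp(P)=\sum_{k\ge0}P^k/k!$ when $(P,1)=0$ and $\log(Q)=\sum_{k\ge1}(-1)^{k-1}(Q-1)^k/k$ when $(Q,1)=1$, put $z_1\vdash\!\dashv\cdots\vdash\!\dashv z_n=\log(\exp(z_1)\cdots\exp(z_n))$ for Lie series $z_1,\dots,z_n$. Let $\Phi$ be the algebra homomorphism from non-commutative polynomials to differential operators on $\mathbb R^N$ with $\Phi(1)=\mathrm{Id}$ and $\Phi(v_i)=V_i$; it maps Lie polynomials to vector fields in $C_b^\infty(\mathbb R^N;\mathbb R^N)$. Put $\Phi_s=\Phi\circ\Psi_s$. **Theorem.** Let $m\ge1$, $M\ge2$,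 and let $Z_1,\dots,Z_M$ be $\mathcal L_{\mathbb R}((A))$-valued random variables on a probability space such that $Z_i=j_mZ_i$ and $E[\|j_mZ_i\|_2]<\infty$ for $i=1,\dots,M$, and $$E\Big[\exp\Big(a\sum_{j=1}^M\|\Phi_s(Z_j)\|_{C^{m+1}}\Big)\Big]<\infty\quad\text{for all } s\in(0,1] \text{ and all } a>0 .$$ Then for every $p\in[1,\infty)$ and all $g_1,\dots,g_M\in\mathcal{IS}(m)$ there is a constant $C>0$, independent of $s$, such that for all $s\in(0,1]$ $$\Big\|\sup_{x\in\mathbb R^N}\Big|g_1(\Phi_s(Z_1))\circ\cdots\circ g_M(\Phi_s(Z_M))(x)-\exp\big(\Phi_s(j_m(Z_M\vdash\!\dashv\cdots\vdash\!\dashv Z_1))\big)(x)\Big|\Big\|_{L^p}\le C\,s^{(m+1)/2}.$$ Here the $L^p$ norm of a possibly non-measurable non-negative function is the infimum of the $L^p$ norms of its measurable majorants. -/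

import Mathlib

open MeasureTheory
open scoped ENNReal

namespace KRK

noncomputable section

/-! ### Non-commutative formal series -/

/-- The alphabet `{v_0, …, v_d}` is `Fin (d + 1)`; words are lists of letters. -/
abbrev Word (d : ℕ) : Type := List (Fin (d + 1))

/-- `ℝ⟪A⟫`: formal series, as families of coefficients `P w = (P, w)`. As a type of functions it
carries the product topology and the product (Borel) σ-algebra. -/
abbrev Series (d : ℕ) : Type := Word d → ℝ

/-- The weight `‖w‖ = |w| + card {k | i_k = 0}` of a word. -/
def weight {d : ℕ} (w : Word d) : ℕ := w.length + w.count 0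

/-- The letter `v_i` as a series. -/
def letter {d : ℕ} (i : Fin (d + 1)) : Series d := fun w => if w = [i] then 1 else 0

/-- The unit of `ℝ⟪A⟫` (the empty word). -/
def sOne (d : ℕ) : Series d := fun w => if w = [] then 1 else 0

/-- The product of series: `(PQ, w) = ∑_{w = uv} (P, u) (Q, v)`. -/
def sMul {d : ℕ} (P Q : Series d) : Series d :=
  fun w => ∑ k ∈ Finset.range (w.length + 1), P (w.take k) * Q (w.drop k)

/-- Powers of a series. -/
def sPow {d : ℕ} (P : Series d) : ℕ → Series d
  | 0 => sOne d
  | k + 1 => sMul P (sPow P k)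

/-- `[P, Q] = PQ - QP`. -/
def sBracket {d : ℕ} (P Q : Series d) : Series d := sMul P Q - sMul Q P

/-- `exp P = 1 + ∑_{k ≥ 1} P^k / k!` for `(P, 1) = 0`; in that case `(P^k, w) = 0` for `k > |w|`, so
that the sum may be stopped at `k = |w|` in the coefficient of `w`. -/
def sExp {d : ℕ} (P : Series d) : Series d :=
  fun w => ∑ k ∈ Finset.range (w.length + 1), sPow P k w / (k.factorial : ℝ)

/-- `log Q = ∑_{k ≥ 1} (-1)^(k-1) (Q - 1)^k / k` for `(Q, 1) = 1`; again only `k ≤ |w|` contribute to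
the coefficient of `w`. -/
def sLog {d : ℕ} (Q : Series d) : Series d :=
  fun w => ∑ k ∈ Finset.Icc 1 w.length, (-1 : ℝ) ^ (k - 1) * sPow (Q - sOne d) k w / (k : ℝ)

/-- The iterated Baker–Campbell–Hausdorff product
`z_1 ⊢⊣ … ⊢⊣ z_n = log (exp z_1 ⋯ exp z_n)` of a list `[z_1, …, z_n]`. -/
def bch {d : ℕ} (l : List (Series d)) : Series d :=
  sLog ((l.map sExp).foldr sMul (sOne d))

/-- The truncation `j_m`. -/
def trunc {d : ℕ} (m : ℕ) (P : Series d) : Series d := fun w => if weight w ≤ m then P w else 0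

/-- The component of weight `k`. -/
def component {d : ℕ} (k : ℕ) (P : Series d) : Series d := fun w => if weight w = k then P w else 0

/-- The rescaling `Ψ_s`: multiplication of the component of weight `k` by `s^(k/2)`. -/
def rescale {d : ℕ} (s : ℝ) (P : Series d) : Series d :=
  fun w => s ^ ((weight w : ℝ) / 2) * P w

/-- `‖P‖₂` of a non-commutative polynomial. -/
def l2Norm {d : ℕ} (P : Series d) : ℝ := Real.sqrt (∑' w, P w ^ 2)

/-- Lie polynomials: the smallest submodule containing the letters and closed under the bracket. -/
inductive IsLiePolynomial {d : ℕ} : Series d → Prop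
  | letter (i : Fin (d + 1)) : IsLiePolynomial (KRK.letter i)
  | zero : IsLiePolynomial 0
  | add {P Q : Series d} : IsLiePolynomial P → IsLiePolynomial Q → IsLiePolynomial (P + Q)
  | smul (c : ℝ) {P : Series d} : IsLiePolynomial P → IsLiePolynomial (c • P)
  | bracket {P Q : Series d} :
      IsLiePolynomial P → IsLiePolynomial Q → IsLiePolynomial (sBracket P Q)

/-- Lie series: all homogeneous components are Lie polynomials. -/
def IsLieSeries {d : ℕ} (P : Series d) : Prop := ∀ k : ℕ, IsLiePolynomial (component k P)

/-! ### Vector fields on `ℝ^N` -/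

/-- `C_b^∞(ℝ^N; ℝ^N)`: smooth, bounded together with all derivatives. -/
def IsCbSmooth {N : ℕ} (W : EuclideanSpace ℝ (Fin N) → EuclideanSpace ℝ (Fin N)) : Prop :=
  ContDiff ℝ ((⊤ : ℕ∞) : WithTop ℕ∞) W ∧ ∀ n : ℕ, ∃ K : ℝ, ∀ x, ‖iteratedFDeriv ℝ n W x‖ ≤ K

/-- `‖W‖_{C^n} = ∑_{i ≤ n} sup_x ‖W^{(i)}(x)‖`, with the operator norm of multilinear maps
(the supremum over unit vectors). Meant for `W` in `C_b^∞`, where the suprema are finite. -/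
def cNorm {N : ℕ} (n : ℕ) (W : EuclideanSpace ℝ (Fin N) → EuclideanSpace ℝ (Fin N)) : ℝ :=
  ∑ i ∈ Finset.range (n + 1), ⨆ x, ‖iteratedFDeriv ℝ i W x‖

/-- A vector field `U` acting on functions: `(U f)(x) = ∑_j U^j(x) ∂f/∂x_j (x)`, also on
vector-valued functions, component by component. -/
def derivAlong {N : ℕ} {F : Type*} [NormedAddCommGroup F] [NormedSpace ℝ F]
    (U : EuclideanSpace ℝ (Fin N) → EuclideanSpace ℝ (Fin N))
    (f : EuclideanSpace ℝ (Fin N) → F) : EuclideanSpace ℝ (Fin N) → F :=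
  fun x => fderiv ℝ f x (U x)

/-- `Φ(v_{i_1} ⋯ v_{i_n}) f = V_{i_1} (V_{i_2} (⋯ (V_{i_n} f)))`. -/
def wordOp {N d : ℕ} {F : Type*} [NormedAddCommGroup F] [NormedSpace ℝ F]
    (V : Fin (d + 1) → EuclideanSpace ℝ (Fin N) → EuclideanSpace ℝ (Fin N))
    (w : Word d) (f : EuclideanSpace ℝ (Fin N) → F) : EuclideanSpace ℝ (Fin N) → F :=
  w.foldr (fun i h => derivAlong (V i) h) f

/-- The differential operator `Φ(P) = ∑_w (P, w) Φ(w)` of a non-commutative polynomial `P`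
(a series with finitely many non-zero coefficients). -/
def phiOp {N d : ℕ} {F : Type*} [NormedAddCommGroup F] [NormedSpace ℝ F]
    (V : Fin (d + 1) → EuclideanSpace ℝ (Fin N) → EuclideanSpace ℝ (Fin N))
    (P : Series d) (f : EuclideanSpace ℝ (Fin N) → F) : EuclideanSpace ℝ (Fin N) → F :=
  fun x => ∑ᶠ w : Word d, P w • wordOp V w f x

/-- For a Lie polynomial `P` the operator `Φ(P)` is a vector field, and the `i`-th component of a
vector field is its value on the coordinate function `x ↦ x_i`: as a function `ℝ^N → ℝ^N`, the
vector field is the operator applied to the identity map. -/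
def phiField {N d : ℕ}
    (V : Fin (d + 1) → EuclideanSpace ℝ (Fin N) → EuclideanSpace ℝ (Fin N))
    (P : Series d) : EuclideanSpace ℝ (Fin N) → EuclideanSpace ℝ (Fin N) :=
  phiOp V P id

/-- `z` solves `dz/dt = W(z)`, `z_0 = x` on `[0, 1]`. -/
def IsSolution {N : ℕ} (W : EuclideanSpace ℝ (Fin N) → EuclideanSpace ℝ (Fin N))
    (x : EuclideanSpace ℝ (Fin N)) (z : ℝ → EuclideanSpace ℝ (Fin N)) : Prop :=
  z 0 = x ∧ ∀ t ∈ Set.Icc (0 : ℝ) 1, HasDerivWithinAt z (W (z t)) (Set.Icc 0 1) t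

open Classical in
/-- `exp(W)(x)`: the value at time `1` of the solution of `dz/dt = W(z)`, `z_0 = x`. For `W` in
`C_b^∞` the solution exists and is unique on `[0, 1]`. -/
def flowExp {N : ℕ} (W : EuclideanSpace ℝ (Fin N) → EuclideanSpace ℝ (Fin N))
    (x : EuclideanSpace ℝ (Fin N)) : EuclideanSpace ℝ (Fin N) :=
  if h : ∃ z, IsSolution W x z then h.choose 1 else x

/-- Integration schemes of order `m`. Only the values of `g` on `C_b^∞` are constrained (and used);
what `g` does to other maps is irrelevant. -/
def IsIntegrationScheme {N : ℕ} (m : ℕ)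
    (g : (EuclideanSpace ℝ (Fin N) → EuclideanSpace ℝ (Fin N)) →
      EuclideanSpace ℝ (Fin N) → EuclideanSpace ℝ (Fin N)) : Prop :=
  ∃ C : ℝ, 0 < C ∧ ∀ W, IsCbSmooth W → ∀ x,
    ‖g W x - flowExp W x‖ ≤ C * cNorm (m + 1) W ^ (m + 1)

/-- The composition `f_1 ∘ f_2 ∘ … ∘ f_M`. -/
def compAll {α : Type*} {M : ℕ} (f : Fin M → α → α) : α → α :=
  (List.ofFn f).foldr (fun h k => h ∘ k) id

/-! ### `L^p` norms -/

/-- The `L^p` norm (in `[0, ∞]`) of a non-negative function, as the infimum of the `L^p` norms of its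
measurable majorants. For measurable functions it is the usual norm; integration schemes are
arbitrary maps, so that the error below need not be measurable. -/
def outerLpNorm {Ω : Type*} [MeasurableSpace Ω] (f : Ω → ℝ≥0∞) (p : ℝ) (μ : Measure Ω) : ℝ≥0∞ :=
  ⨅ (G : Ω → ℝ≥0∞) (_ : Measurable G) (_ : ∀ ω, f ω ≤ G ω), eLpNorm G (ENNReal.ofReal p) μ

end

end KRK

open KRK

/-! Composition with a flow is formally an exponential of operators, `f ∘ exp(W) = e^W f`. Hence the
composed flows of Φ_s(Z_1), …, Φ_s(Z_M) have the expansion Φ_s(exp Z_M ⋯ exp Z_1) applied to the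
identity map, whence the reversed order. The flow of Φ_s(L), with L = j_m log(exp Z_M ⋯ exp Z_1),
has the same expansion up to weight m. That L is a Lie polynomial, so that Φ_s(L) is a vector field,
is the Baker–Campbell–Hausdorff theorem `lg_expProd_mem_lieSer`; its proof compares logarithmic
derivatives with respect to the derivation `wt`.

With t = √s, a word of weight k carries the factor t^k, so all terms of weight above m are
O(t^(m+1)) (`exists_cNorm_phiField_le`). Taylor expansion along a flow makes the formal identity
quantitative (`norm_phiField_flowExp_sub_le`, `exists_flow_step`), `exists_flow_comp` iterates it,
and Grönwall's inequality propagates the errors of the schemes. The outcome is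
`exists_scheme_error_le`: the error is at most C t^(m+1) exp(c R) as soon as R bounds all
coefficients of the Z_i.

The moment hypothesis, however, controls the fields Φ_s(Z_i) and not the coefficients, since
different Lie polynomials may define the same fields. Each Z_i is therefore replaced by a Lie
polynomial with the same fields for every s, whose coefficients are bounded by finitely many values
of those fields (`exists_bounded_representative`). The difference lies in `nullSer`, a two-sided
ideal of series acting as zero; congruence modulo this ideal is preserved by exp and log, so the
target field is unchanged as well. The resulting R is dominated by C^(m+1) norms at finitely many
fixed values of s: it has all exponential moments and does not depend on the s of the estimate. -/

namespace KRK

noncomputable section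

/-! ### The algebra of non-commutative series -/

section weight

variable {d : ℕ}

theorem weight_nil : weight ([] : Word d) = 0 := by simp [weight]

theorem weight_append (u v : Word d) : weight (u ++ v) = weight u + weight v := by
  simp only [weight, List.length_append, List.count_append]; ring

theorem length_le_weight (w : Word d) : w.length ≤ weight w := Nat.le_add_right _ _

theorem weight_eq_zero {w : Word d} : weight w = 0 ↔ w = [] := by
  constructor
  · intro h
    have := length_le_weight w
    exact List.length_eq_zero_iff.mp (by omega)
  · rintro rfl; exact weight_nil

theorem weight_take_add_drop (w : Word d) (k : ℕ) :
    weight (w.take k) + weight (w.drop k) = weight w := by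
  rw [← weight_append, List.take_append_drop]

theorem finite_weight_le (d n : ℕ) : {w : Word d | weight w ≤ n}.Finite :=
  (List.finite_length_le (Fin (d + 1)) n).subset fun w hw => (length_le_weight w).trans hw

/-- The finite set of words of weight at most `n`. -/
def wordsLE (d n : ℕ) : Finset (Word d) := (finite_weight_le d n).toFinset

theorem mem_wordsLE {n : ℕ} {w : Word d} : w ∈ wordsLE d n ↔ weight w ≤ n := by
  simp [wordsLE]

end weight

/-- The space of series, equipped with the non-commutative (concatenation) product. -/
def NC (d : ℕ) : Type := Word d → ℝ

namespace NC

variable {d : ℕ}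

instance : AddCommGroup (NC d) := inferInstanceAs (AddCommGroup (Word d → ℝ))
instance : Module ℝ (NC d) := inferInstanceAs (Module ℝ (Word d → ℝ))
instance : Mul (NC d) := ⟨fun P Q => sMul P Q⟩
instance : One (NC d) := ⟨sOne d⟩

/-- The coefficient of a word. -/
def coef (w : Word d) : NC d →ₗ[ℝ] ℝ where
  toFun P := P w
  map_add' _ _ := rfl
  map_smul' _ _ := rfl

@[ext] theorem ext {P Q : NC d} (h : ∀ w, coef w P = coef w Q) : P = Q := funext h

/-- A series from its coefficients. -/
def mk (P : Series d) : NC d := P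

@[simp] theorem coef_mk (w : Word d) (P : Series d) : coef w (mk P) = P w := rfl

theorem coef_mul (w : Word d) (P Q : NC d) :
    coef w (P * Q) = ∑ k ∈ Finset.range (w.length + 1), coef (w.take k) P * coef (w.drop k) Q := rfl

theorem coef_one (w : Word d) : coef w (1 : NC d) = if w = [] then 1 else 0 := rfl

/-- The series of the coefficients of the words starting with `a`. -/
def tail (a : Fin (d + 1)) (P : NC d) : NC d := mk fun w => coef (a :: w) P

@[simp] theorem coef_tail (a : Fin (d + 1)) (w : Word d) (P : NC d) :
    coef w (tail a P) = coef (a :: w) P := rfl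

theorem coef_nil_mul (P Q : NC d) : coef [] (P * Q) = coef [] P * coef [] Q := by
  simp [coef_mul]

theorem coef_cons_mul (a : Fin (d + 1)) (w : Word d) (P Q : NC d) :
    coef (a :: w) (P * Q) = coef [] P * coef (a :: w) Q + coef w (tail a P * Q) := by
  rw [coef_mul, coef_mul, List.length_cons, Finset.sum_range_succ', add_comm]
  simp

/-- Stripping the first letter turns a product into a combination of products with shorter words to
test, so induction on the word works once `P` and `Q` are left free. -/
theorem mul_assoc' (P Q R : NC d) : P * Q * R = P * (Q * R) := by
  ext w
  induction w generalizing P Q with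
  | nil => simp only [coef_nil_mul, mul_assoc]
  | cons a w ih =>
    have h : tail a (P * Q) = coef [] P • tail a Q + tail a P * Q := by
      ext v; simp [coef_cons_mul]
    have add_mul' : ∀ X Y Z : NC d, coef w ((X + Y) * Z) = coef w (X * Z) + coef w (Y * Z) := by
      intro X Y Z; simp [coef_mul, add_mul, Finset.sum_add_distrib]
    have smul_mul' : ∀ (c : ℝ) (X Z : NC d), coef w ((c • X) * Z) = c * coef w (X * Z) := by
      intro c X Z; simp [coef_mul, Finset.mul_sum, mul_assoc]
    rw [coef_cons_mul, coef_cons_mul, coef_cons_mul, coef_nil_mul, h, add_mul', smul_mul', ih]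
    ring

instance : Ring (NC d) where
  __ := (inferInstance : AddCommGroup (NC d))
  mul_assoc := mul_assoc'
  one_mul P := by
    ext w
    cases w with
    | nil => simp [coef_nil_mul, coef_one]
    | cons a w =>
      have : ∀ v, coef v (tail a (1 : NC d)) = 0 := by intro v; simp [coef_one]
      rw [coef_cons_mul, coef_one, coef_mul]; simp [this]
  mul_one P := by
    ext w
    induction w generalizing P with
    | nil => simp [coef_nil_mul, coef_one]
    | cons a w ih => rw [coef_cons_mul, ih]; simp [coef_one]
  left_distrib P Q R := by
    ext w; simp [coef_mul, mul_add, Finset.sum_add_distrib]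
  right_distrib P Q R := by
    ext w; simp [coef_mul, add_mul, Finset.sum_add_distrib]
  zero_mul P := by ext w; simp [coef_mul]
  mul_zero P := by ext w; simp [coef_mul]

instance : Algebra ℝ (NC d) := Algebra.ofModule
  (fun c P Q => by ext w; simp [coef_mul, Finset.mul_sum, mul_assoc])
  (fun c P Q => by
    ext w; simp only [coef_mul, map_smul, smul_eq_mul, Finset.mul_sum]
    exact Finset.sum_congr rfl fun _ _ => by ring)

theorem sPow_eq (P : NC d) (k : ℕ) : sPow P k = P ^ k := by
  induction k with
  | zero => rfl
  | succ k ih => rw [pow_succ', ← ih]; rfl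

/-! ### Filtration and grading by weight -/

/-- The series without terms of weight less than `n`. -/
def fil (d n : ℕ) : Submodule ℝ (NC d) where
  carrier := {P | ∀ w, weight w < n → coef w P = 0}
  add_mem' hP hQ w hw := by simp [hP w hw, hQ w hw]
  zero_mem' w _ := by simp
  smul_mem' c P hP w hw := by simp [hP w hw]

theorem fil_anti {i j : ℕ} (h : i ≤ j) : fil d j ≤ fil d i :=
  fun _ hP w hw => hP w (hw.trans_le h)

theorem mem_fil_zero (P : NC d) : P ∈ fil d 0 := fun _ hw => absurd hw (Nat.not_lt_zero _)

theorem mem_fil_one {P : NC d} : P ∈ fil d 1 ↔ coef [] P = 0 := by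
  constructor
  · intro h; exact h [] (by simp [weight_nil])
  · intro h w hw
    rw [weight_eq_zero.mp (Nat.lt_one_iff.mp hw), h]

theorem mul_mem_fil {i j : ℕ} {P Q : NC d} (hP : P ∈ fil d i) (hQ : Q ∈ fil d j) :
    P * Q ∈ fil d (i + j) := by
  intro w hw
  rw [coef_mul]
  refine Finset.sum_eq_zero fun k _ => ?_
  have := weight_take_add_drop w k
  rcases lt_or_ge (weight (w.take k)) i with h | h
  · rw [hP _ h, zero_mul]
  · rw [hQ _ (by omega), mul_zero]

theorem mul_mem_fil_left {n : ℕ} {Q : NC d} (P : NC d) (hQ : Q ∈ fil d n) : P * Q ∈ fil d n := by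
  simpa using mul_mem_fil (mem_fil_zero P) hQ

theorem mul_mem_fil_right {n : ℕ} {P : NC d} (hP : P ∈ fil d n) (Q : NC d) : P * Q ∈ fil d n := by
  simpa using mul_mem_fil hP (mem_fil_zero Q)

theorem pow_mem_fil {P : NC d} (hP : P ∈ fil d 1) (k : ℕ) : P ^ k ∈ fil d k := by
  induction k with
  | zero => exact mem_fil_zero _
  | succ k ih => rw [pow_succ]; exact mul_mem_fil ih hP

/-- Each factor without constant term uses up at least one letter. The count is by length, not
weight, because the sums defining `sExp` and `sLog` stop at the length of the word. -/
theorem coef_pow_of_length_lt {P : NC d} (hP : P ∈ fil d 1) (k : ℕ) {w : Word d}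
    (hw : w.length < k) : coef w (P ^ k) = 0 := by
  induction k generalizing w with
  | zero => omega
  | succ k ih =>
    rw [pow_succ', coef_mul]
    refine Finset.sum_eq_zero fun j _ => ?_
    rcases Nat.eq_zero_or_pos j with rfl | hj
    · rw [List.take_zero, mem_fil_one.mp hP, zero_mul]
    · rcases Nat.eq_zero_or_pos w.length with h0 | h0
      · rw [List.length_eq_zero_iff.mp h0, List.take_nil, mem_fil_one.mp hP, zero_mul]
      · rw [ih (by rw [List.length_drop]; omega), mul_zero]

/-- The series whose terms have weight at most `n`. -/
def poly (d n : ℕ) : Submodule ℝ (NC d) where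
  carrier := {P | ∀ w, n < weight w → coef w P = 0}
  add_mem' hP hQ w hw := by simp [hP w hw, hQ w hw]
  zero_mem' w _ := by simp
  smul_mem' c P hP w hw := by simp [hP w hw]

theorem poly_mono {i j : ℕ} (h : i ≤ j) : poly d i ≤ poly d j :=
  fun _ hP w hw => hP w (h.trans_lt hw)

theorem one_mem_poly (n : ℕ) : (1 : NC d) ∈ poly d n := by
  intro w hw
  rw [coef_one, if_neg]
  rintro rfl
  simp [weight_nil] at hw

theorem mul_mem_poly {i j : ℕ} {P Q : NC d} (hP : P ∈ poly d i) (hQ : Q ∈ poly d j) :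
    P * Q ∈ poly d (i + j) := by
  intro w hw
  rw [coef_mul]
  refine Finset.sum_eq_zero fun k _ => ?_
  have := weight_take_add_drop w k
  rcases lt_or_ge i (weight (w.take k)) with h | h
  · rw [hP _ h, zero_mul]
  · rw [hQ _ (by omega), mul_zero]

theorem pow_mem_poly {n : ℕ} {P : NC d} (hP : P ∈ poly d n) (k : ℕ) : P ^ k ∈ poly d (k * n) := by
  induction k with
  | zero => exact one_mem_poly _
  | succ k ih => rw [pow_succ, Nat.succ_mul]; exact mul_mem_poly ih hP

/-- Coefficientwise multiplication by a function of the word. -/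
def mask (c : Word d → ℝ) : NC d →ₗ[ℝ] NC d where
  toFun P := mk fun w => c w * coef w P
  map_add' P Q := by ext w; simp [mul_add]
  map_smul' a P := by ext w; simp only [coef_mk, map_smul, smul_eq_mul, RingHom.id_apply]; ring

@[simp] theorem coef_mask (c : Word d → ℝ) (w : Word d) (P : NC d) :
    coef w (mask c P) = c w * coef w P := rfl

/-- Truncation as a linear map. -/
def tr (m : ℕ) : NC d →ₗ[ℝ] NC d := mask fun w => if weight w ≤ m then 1 else 0

theorem coef_tr (m : ℕ) (w : Word d) (P : NC d) :
    coef w (tr m P) = if weight w ≤ m then coef w P else 0 := by simp [tr]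

theorem mk_trunc (m : ℕ) (P : NC d) : mk (trunc m P) = tr m P := by
  ext w; rw [coef_tr]; rfl

/-- Homogeneous components as a linear map. -/
def cp (k : ℕ) : NC d →ₗ[ℝ] NC d := mask fun w => if weight w = k then 1 else 0

theorem coef_cp (k : ℕ) (w : Word d) (P : NC d) :
    coef w (cp k P) = if weight w = k then coef w P else 0 := by simp [cp]

theorem mk_component (k : ℕ) (P : NC d) : mk (component k P) = cp k P := by
  ext w; rw [coef_cp]; rfl

/-- The rescaling of the component of weight `k` by `t ^ k`. -/
def rs (t : ℝ) : NC d →ₐ[ℝ] NC d := AlgHom.ofLinearMap (mask fun w => t ^ weight w)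
  (by ext w; by_cases hw : w = [] <;> simp [coef_one, hw, weight_nil])
  (by
    intro P Q
    ext w
    simp only [coef_mask, coef_mul, Finset.mul_sum]
    refine Finset.sum_congr rfl fun k _ => ?_
    rw [← weight_take_add_drop w k, pow_add]; ring)

@[simp] theorem coef_rs (t : ℝ) (w : Word d) (P : NC d) :
    coef w (rs t P) = t ^ weight w * coef w P := rfl

/-- In the parameter `√s` the half-integer powers become natural powers, and the rescaling becomes
polynomial in its parameter. -/
theorem mk_rescale {s : ℝ} (hs : 0 ≤ s) (P : NC d) : mk (rescale s P) = rs (√s) P := by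
  ext w
  change s ^ ((weight w : ℝ) / 2) * coef w P = _
  rw [coef_rs, Real.sqrt_eq_rpow, ← Real.rpow_natCast, ← Real.rpow_mul hs]
  congr 2; ring

/-- The derivation that multiplies the component of weight `k` by `k`. -/
def wt : NC d →ₗ[ℝ] NC d := mask fun w => (weight w : ℝ)

@[simp] theorem coef_wt (w : Word d) (P : NC d) : coef w (wt P) = weight w * coef w P := rfl

/-- Weight is additive under concatenation, so this Euler operator obeys the Leibniz rule. -/
theorem wt_mul (P Q : NC d) : wt (P * Q) = wt P * Q + P * wt Q := by
  ext w
  simp only [coef_wt, coef_mul, map_add, Finset.mul_sum, ← Finset.sum_add_distrib]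
  refine Finset.sum_congr rfl fun k _ => ?_
  rw [← weight_take_add_drop w k]; push_cast; ring

theorem wt_mem_fil {n : ℕ} {P : NC d} (hP : P ∈ fil d n) : wt P ∈ fil d n :=
  fun w hw => by rw [coef_wt, hP w hw, mul_zero]

theorem sub_tr_mem_fil (n : ℕ) (P : NC d) : P - tr n P ∈ fil d (n + 1) := by
  intro w hw; rw [map_sub, coef_tr, if_pos (by omega), sub_self]

theorem tr_mem_poly (n : ℕ) (P : NC d) : tr n P ∈ poly d n := by
  intro w hw; rw [coef_tr, if_neg (by omega)]

theorem tr_eq_self {n : ℕ} {P : NC d} (hP : P ∈ poly d n) : tr n P = P := by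
  ext w; rw [coef_tr]; split_ifs with h
  · rfl
  · rw [hP w (by omega)]

theorem tr_eq_zero_iff {n : ℕ} {P : NC d} : tr n P = 0 ↔ P ∈ fil d (n + 1) := by
  constructor
  · intro h w hw
    have := congrArg (coef w) h
    rwa [coef_tr, if_pos (by omega), map_zero] at this
  · intro h; ext w; rw [coef_tr]; split_ifs with hw
    · rw [h w (by omega), map_zero]
    · rw [map_zero]

theorem tr_eq_tr_iff {n : ℕ} {P Q : NC d} : tr n P = tr n Q ↔ P - Q ∈ fil d (n + 1) := by
  rw [← tr_eq_zero_iff, map_sub, sub_eq_zero]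

theorem cp_eq_of_sub_mem {n k : ℕ} (hk : k < n) {P Q : NC d} (h : P - Q ∈ fil d n) :
    cp k P = cp k Q := by
  ext w; rw [coef_cp, coef_cp]; split_ifs with hw
  · have := h w (by omega); rwa [map_sub, sub_eq_zero] at this
  · rfl

theorem cp_mul (k : ℕ) (P Q : NC d) :
    cp k (P * Q) = ∑ p ∈ Finset.HasAntidiagonal.antidiagonal k, cp p.1 P * cp p.2 Q := by
  ext w
  simp only [map_sum, coef_mul, coef_cp]
  rw [Finset.sum_comm]
  split_ifs with h
  · refine Finset.sum_congr rfl fun j _ => ?_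
    have := weight_take_add_drop w j
    rw [Finset.sum_eq_single (weight (w.take j), weight (w.drop j))]
    · simp
    · rintro ⟨a, b⟩ _ hne
      simp only [ne_eq, Prod.mk.injEq, not_and_or] at hne
      rcases hne with h1 | h1
      · rw [if_neg (fun h => h1 h.symm), zero_mul]
      · rw [if_neg (c := weight (w.drop j) = b) (fun h => h1 h.symm), mul_zero]
    · intro hn; exact absurd (Finset.HasAntidiagonal.mem_antidiagonal.mpr (this.trans h)) hn
  · symm
    refine Finset.sum_eq_zero fun j _ => Finset.sum_eq_zero fun p hp => ?_
    have := weight_take_add_drop w j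
    rw [Finset.HasAntidiagonal.mem_antidiagonal] at hp
    by_cases h1 : weight (w.take j) = p.1
    · rw [if_neg (c := weight (w.drop j) = p.2) (by omega), mul_zero]
    · rw [if_neg h1, zero_mul]

theorem cp_wt (k : ℕ) (P : NC d) : cp k (wt P) = (k : ℝ) • cp k P := by
  ext w; simp only [coef_cp, coef_wt, map_smul, smul_eq_mul]; split_ifs with h
  · rw [h]
  · simp

theorem cp_rs (k : ℕ) (t : ℝ) (P : NC d) : cp k (rs t P) = t ^ k • cp k P := by
  ext w; simp only [coef_cp, coef_rs, map_smul, smul_eq_mul]; split_ifs with h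
  · rw [h]
  · simp

theorem cp_tr (k n : ℕ) (P : NC d) : cp k (tr n P) = if k ≤ n then cp k P else 0 := by
  ext w
  by_cases h : k ≤ n
  · rw [if_pos h]; simp only [coef_cp, coef_tr]; split_ifs <;> first | omega | rfl
  · rw [if_neg h, map_zero, coef_cp, coef_tr]; split_ifs <;> first | omega | rfl

theorem sum_cp {n : ℕ} {P : NC d} (hP : P ∈ poly d n) :
    ∑ k ∈ Finset.range (n + 1), cp k P = P := by
  ext w
  simp only [map_sum, coef_cp, Finset.sum_ite_eq, Finset.mem_range]
  split_ifs with h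
  · rfl
  · rw [hP w (by omega)]

theorem cp_mem_poly (k : ℕ) (P : NC d) : cp k P ∈ poly d k := by
  intro w hw; rw [coef_cp, if_neg (by omega)]

theorem cp_eq_zero_of_mem_fil {n k : ℕ} (hk : k < n) {P : NC d} (h : P ∈ fil d n) : cp k P = 0 := by
  rw [cp_eq_of_sub_mem hk (Q := 0) (by simpa using h), map_zero]

/-- Products of partial sums agree with the partial sums of the Cauchy product up to terms of high
weight. -/
theorem sum_mul_sum_sub_mem_fil {a b : ℕ → NC d} (ha : ∀ i, a i ∈ fil d i)
    (hb : ∀ i, b i ∈ fil d i) (n : ℕ) :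
    (∑ i ∈ Finset.range n, a i) * (∑ j ∈ Finset.range n, b j)
      - ∑ k ∈ Finset.range n, ∑ p ∈ Finset.HasAntidiagonal.antidiagonal k, a p.1 * b p.2 ∈ fil d n := by
  have h : ∑ k ∈ Finset.range n, ∑ p ∈ Finset.HasAntidiagonal.antidiagonal k, a p.1 * b p.2
      = ∑ p ∈ Finset.range n ×ˢ Finset.range n with p.1 + p.2 < n, a p.1 * b p.2 := by
    rw [Finset.sum_sigma']
    refine Finset.sum_bij' (fun x _ => x.2) (fun p _ => ⟨p.1 + p.2, p⟩) ?_ ?_ ?_ ?_ ?_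
    · rintro ⟨k, p⟩ hx
      simp only [Finset.mem_sigma, Finset.mem_range, Finset.HasAntidiagonal.mem_antidiagonal] at hx
      simp only [Finset.mem_filter, Finset.mem_product, Finset.mem_range]
      omega
    · rintro p hp
      simp only [Finset.mem_filter, Finset.mem_product, Finset.mem_range] at hp
      simp [hp.2]
    · rintro ⟨k, p⟩ hx
      simp only [Finset.mem_sigma, Finset.mem_range, Finset.HasAntidiagonal.mem_antidiagonal] at hx
      obtain ⟨_, rfl⟩ := hx
      rfl
    · intro p _; rfl
    · intro x _; rfl
  rw [h, Finset.sum_mul_sum, ← Finset.sum_product',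
    ← Finset.sum_filter_add_sum_filter_not _ (fun p : ℕ × ℕ => p.1 + p.2 < n), add_sub_cancel_left]
  refine Submodule.sum_mem _ fun p hp => ?_
  rw [Finset.mem_filter] at hp
  exact fil_anti (not_lt.mp hp.2) (mul_mem_fil (ha _) (hb _))

end NC

/-! ### Exponential and logarithm -/

section polynomial

open Polynomial

/-- The truncated logarithm series. -/
def logPoly (n : ℕ) : ℝ[X] := ∑ k ∈ Finset.range n, C ((-1 : ℝ) ^ k / (k + 1)) * X ^ (k + 1)

theorem X_dvd_logPoly (n : ℕ) : X ∣ logPoly n :=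
  Finset.dvd_sum fun k _ => Dvd.dvd.mul_left (dvd_pow_self X (Nat.succ_ne_zero k)) _

theorem one_add_X_mul_derivative_logPoly (n : ℕ) :
    (1 + X) * derivative (logPoly n) = 1 - (-X) ^ n := by
  have h : derivative (logPoly n) = ∑ k ∈ Finset.range n, (-X : ℝ[X]) ^ k := by
    rw [logPoly, derivative_sum]
    refine Finset.sum_congr rfl fun k _ => ?_
    rw [derivative_C_mul_X_pow, neg_pow (X : ℝ[X]) k]
    have : ((k : ℝ) + 1) ≠ 0 := by positivity
    rw [Nat.cast_add, Nat.cast_one, div_mul_cancel₀ _ this]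
    simp
  rw [h, mul_comm, ← geom_sum_mul_neg]
  simp

/-- `exp (log (1 + X)) = 1 + X` up to order `n`. -/
theorem X_pow_dvd_exp_logPoly_sub (n : ℕ) :
    (X : ℝ[X]) ^ (n + 1) ∣
      ∑ k ∈ Finset.range (n + 1), C ((k.factorial : ℝ)⁻¹) * logPoly n ^ k - (1 + X) := by
  set p := logPoly n with hp
  set S := ∑ k ∈ Finset.range (n + 1), C ((k.factorial : ℝ)⁻¹) * p ^ k with hS
  have hS' : derivative S = derivative p * (S - C ((n.factorial : ℝ)⁻¹) * p ^ n) := by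
    rw [hS, Finset.sum_range_succ, add_sub_cancel_right, ← Finset.sum_range_succ,
      Finset.sum_range_succ', derivative_add, derivative_sum]
    simp only [pow_zero, mul_one, derivative_C, add_zero, Finset.mul_sum]
    refine Finset.sum_congr rfl fun k _ => ?_
    rw [derivative_C_mul, derivative_pow_succ, Nat.factorial_succ]
    have h1 : (C (((k + 1) * k.factorial : ℕ) : ℝ)⁻¹ : ℝ[X]) * C ((k : ℝ) + 1)
        = C ((k.factorial : ℝ)⁻¹) := by
      rw [← C_mul]; congr 1
      have : ((k : ℝ) + 1) ≠ 0 := by positivity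
      push_cast; field_simp
    rw [← h1]; push_cast; ring
  -- Modulo `X ^ n`, `S` solves the differential equation `(1 + X) S' = S` of `1 + X`; the initial
  -- value is `c0`.
  have key : (X : ℝ[X]) ^ n ∣ (1 + X) * derivative S - S := by
    have : (1 + X) * derivative S - S
        = -(-X) ^ n * S - (1 - (-X) ^ n) * (C ((n.factorial : ℝ)⁻¹) * p ^ n) := by
      rw [hS', ← mul_assoc, one_add_X_mul_derivative_logPoly]; ring
    rw [this]
    refine dvd_sub (Dvd.dvd.mul_right ?_ _) (Dvd.dvd.mul_left (Dvd.dvd.mul_left ?_ _) _)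
    · rw [neg_pow]; exact (Dvd.dvd.mul_left dvd_rfl _).neg_right
    · exact pow_dvd_pow_of_dvd (X_dvd_logPoly n) n
  rw [X_pow_dvd_iff] at key ⊢
  have c0 : S.coeff 0 = 1 := by
    have hp0 : p.coeff 0 = 0 := by
      have := X_dvd_iff.mp (X_dvd_logPoly n); exact this
    rw [hS, finsetSum_coeff, Finset.sum_range_succ', Finset.sum_eq_zero]
    · simp
    · intro k _
      rw [coeff_C_mul, coeff_zero_eq_eval_zero, eval_pow, ← coeff_zero_eq_eval_zero, hp0]
      simp
  -- The factor `1 - j` vanishes at `j = 1`, which kills every coefficient from degree 2 on.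
  have hrec : ∀ j < n, ((j : ℝ) + 1) * S.coeff (j + 1) = (1 - j) * S.coeff j := by
    intro j hj
    have h := key j hj
    rw [coeff_sub, add_mul, one_mul, coeff_add, coeff_derivative] at h
    rcases j with _ | j
    · simp at h ⊢; linarith
    · rw [coeff_X_mul, coeff_derivative] at h
      push_cast at h ⊢; linarith
  intro j hj
  rw [coeff_sub, sub_eq_zero]
  rcases j with _ | _ | j
  · simpa using c0
  · have := hrec 0 (by omega)
    simp [c0] at this; simp [this, coeff_one]
  · have : ∀ i, i + 2 < n + 1 → S.coeff (i + 2) = 0 := by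
      intro i
      induction i with
      | zero =>
        intro hi
        have := hrec 1 (by omega)
        norm_num at this; exact this
      | succ i ih =>
        intro hi
        have := hrec (i + 2) (by omega)
        rw [ih (by omega), mul_zero] at this
        refine (mul_eq_zero.mp this).resolve_left ?_
        positivity
    rw [this j hj]
    simp [coeff_one, coeff_X]

end polynomial

/-! ### Congruences modulo high weight, and the exponential and logarithm of series -/

namespace NC

variable {d : ℕ}

theorem eq_of_forall_sub_mem_fil {P Q : NC d} (h : ∀ n, P - Q ∈ fil d (n + 1)) : P = Q := by
  ext w
  have := h (weight w) w (by omega)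
  rwa [map_sub, sub_eq_zero] at this

theorem sub_mem_fil_trans {n : ℕ} {P Q R : NC d} (h : P - Q ∈ fil d n) (h' : Q - R ∈ fil d n) :
    P - R ∈ fil d n := by simpa using Submodule.add_mem _ h h'

theorem sub_mem_fil_symm {n : ℕ} {P Q : NC d} (h : P - Q ∈ fil d n) : Q - P ∈ fil d n := by
  simpa using Submodule.neg_mem _ h

theorem mul_sub_mul_mem_fil {n : ℕ} {P P' Q Q' : NC d} (h : P - P' ∈ fil d n)
    (h' : Q - Q' ∈ fil d n) : P * Q - P' * Q' ∈ fil d n := by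
  have : P * Q - P' * Q' = (P - P') * Q + P' * (Q - Q') := by noncomm_ring
  rw [this]
  exact Submodule.add_mem _ (mul_mem_fil_right h _) (mul_mem_fil_left _ h')

theorem pow_sub_pow_mem_fil {n : ℕ} {P P' : NC d} (h : P - P' ∈ fil d n) (k : ℕ) :
    P ^ k - P' ^ k ∈ fil d n := by
  induction k with
  | zero => simp
  | succ k ih => rw [pow_succ, pow_succ]; exact mul_sub_mul_mem_fil ih h

/-- The exponential of a series. -/
def ex (P : NC d) : NC d := mk (sExp P)

/-- The logarithm of a series. -/
def lg (Q : NC d) : NC d := mk (sLog Q)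

theorem coef_ex (w : Word d) (P : NC d) :
    coef w (ex P) = ∑ k ∈ Finset.range (w.length + 1), (k.factorial : ℝ)⁻¹ * coef w (P ^ k) := by
  change ∑ k ∈ Finset.range (w.length + 1), sPow P k w / (k.factorial : ℝ) = _
  refine Finset.sum_congr rfl fun k _ => ?_
  rw [sPow_eq, div_eq_inv_mul]; rfl

theorem coef_lg (w : Word d) (Q : NC d) :
    coef w (lg Q)
      = ∑ k ∈ Finset.range w.length, ((-1 : ℝ) ^ k / (k + 1)) * coef w ((Q - 1) ^ (k + 1)) := by
  have h : coef w (lg Q)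
      = ∑ k ∈ Finset.Icc 1 w.length, (-1 : ℝ) ^ (k - 1) * coef w ((Q - 1) ^ k) / (k : ℝ) := by
    simp only [← sPow_eq]; rfl
  have key : ∀ (f : ℕ → ℝ) (n : ℕ),
      ∑ k ∈ Finset.Icc 1 n, f k = ∑ k ∈ Finset.range n, f (k + 1) := by
    intro f n
    rw [Finset.range_eq_Ico, Finset.sum_Ico_add' f 0 n 1, zero_add,
      Finset.Ico_add_one_right_eq_Icc]
  rw [h, key]
  refine Finset.sum_congr rfl fun k _ => ?_
  rw [Nat.add_sub_cancel, div_mul_eq_mul_div]; push_cast; rfl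

/-- The cut-off of `sExp` varies with the word, but length is at most weight and the powers beyond
the length vanish, so one common partial sum serves all words of weight below `n`. -/
theorem ex_sub_mem_fil {P : NC d} (hP : P ∈ fil d 1) (n : ℕ) :
    ex P - ∑ k ∈ Finset.range n, (k.factorial : ℝ)⁻¹ • P ^ k ∈ fil d n := by
  intro w hw
  rw [map_sub, coef_ex, map_sum, sub_eq_zero]
  simp only [map_smul, smul_eq_mul]
  refine Finset.sum_subset (Finset.range_mono ?_) fun k _ hk => ?_
  · have := length_le_weight w; omega
  · rw [coef_pow_of_length_lt hP, mul_zero]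
    rw [Finset.mem_range] at hk; omega

/-- The `n` terms are the powers `1, …, n`, hence the gain of one order over the exponential. -/
theorem lg_sub_mem_fil {Q : NC d} (hQ : Q - 1 ∈ fil d 1) (n : ℕ) :
    lg Q - ∑ k ∈ Finset.range n, ((-1 : ℝ) ^ k / (k + 1)) • (Q - 1) ^ (k + 1) ∈ fil d (n + 1) := by
  intro w hw
  rw [map_sub, coef_lg, map_sum, sub_eq_zero]
  simp only [map_smul, smul_eq_mul]
  refine Finset.sum_subset (Finset.range_mono ?_) fun k _ hk => ?_
  · have := length_le_weight w; omega
  · rw [coef_pow_of_length_lt hQ, mul_zero]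
    rw [Finset.mem_range] at hk; omega

theorem ex_sub_one_mem_fil {P : NC d} (hP : P ∈ fil d 1) : ex P - 1 ∈ fil d 1 := by
  simpa using ex_sub_mem_fil hP 1

theorem lg_mem_fil {Q : NC d} (hQ : Q - 1 ∈ fil d 1) : lg Q ∈ fil d 1 := by
  simpa using lg_sub_mem_fil hQ 0

theorem ex_sub_ex_mem_fil {n : ℕ} {P P' : NC d} (hP : P ∈ fil d 1) (hP' : P' ∈ fil d 1)
    (h : P - P' ∈ fil d n) : ex P - ex P' ∈ fil d n := by
  refine sub_mem_fil_trans (ex_sub_mem_fil hP n) (sub_mem_fil_trans ?_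
    (sub_mem_fil_symm (ex_sub_mem_fil hP' n)))
  rw [← Finset.sum_sub_distrib]
  refine Submodule.sum_mem _ fun k _ => ?_
  rw [← smul_sub]
  exact Submodule.smul_mem _ _ (pow_sub_pow_mem_fil h k)

/-- Only powers of `Q - 1` occur, so this is the one-variable identity for `logPoly` evaluated at `Q
- 1`, where `X ^ (n + 1)` becomes a series of order `n + 1`. -/
theorem ex_lg {Q : NC d} (hQ : Q - 1 ∈ fil d 1) : ex (lg Q) = Q := by
  refine eq_of_forall_sub_mem_fil fun n => ?_
  set U := Q - 1 with hU
  have h1 : lg Q - Polynomial.aeval U (logPoly n) ∈ fil d (n + 1) := by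
    convert lg_sub_mem_fil hQ n using 2
    simp [logPoly, Algebra.smul_def, hU]
  have h2 := ex_sub_mem_fil (lg_mem_fil hQ) (n + 1)
  have h3 : ∑ k ∈ Finset.range (n + 1), (k.factorial : ℝ)⁻¹ • lg Q ^ k
      - Polynomial.aeval U (∑ k ∈ Finset.range (n + 1),
        Polynomial.C ((k.factorial : ℝ)⁻¹) * logPoly n ^ k) ∈ fil d (n + 1) := by
    rw [map_sum, ← Finset.sum_sub_distrib]
    refine Submodule.sum_mem _ fun k _ => ?_
    rw [map_mul, Polynomial.aeval_C, ← Algebra.smul_def, map_pow, ← smul_sub]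
    exact Submodule.smul_mem _ _ (pow_sub_pow_mem_fil h1 k)
  have h4 : Polynomial.aeval U (∑ k ∈ Finset.range (n + 1),
        Polynomial.C ((k.factorial : ℝ)⁻¹) * logPoly n ^ k) - Q ∈ fil d (n + 1) := by
    have : Q = Polynomial.aeval U (1 + Polynomial.X : Polynomial ℝ) := by simp [hU]
    have e : ∀ X : NC d, X - Q = X - Polynomial.aeval U (1 + Polynomial.X : Polynomial ℝ) := by
      intro X; rw [← this]
    rw [e, ← map_sub]
    obtain ⟨q, hq⟩ := X_pow_dvd_exp_logPoly_sub n
    rw [hq, map_mul, map_pow, Polynomial.aeval_X]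
    exact mul_mem_fil_right (pow_mem_fil hQ _) _
  exact sub_mem_fil_trans h2 (sub_mem_fil_trans h3 h4)

end NC

/-! ### Commutation with powers -/

section ad

variable {A : Type*} [Ring A] [Algebra ℝ A]

/-- The operator `X ↦ z X - X z`. -/
def adj (z : A) : A →ₗ[ℝ] A := LinearMap.mulLeft ℝ z - LinearMap.mulRight ℝ z

theorem adj_apply (z X : A) : adj z X = z * X - X * z := by simp [adj]

/-- Left multiplication by `z` is the sum of the commuting operators `adj z` and right
multiplication by `z`; this is the binomial theorem for that sum. -/
theorem divPow_mul_eq_sum (z X : A) (k : ℕ) :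
    ((k.factorial : ℝ)⁻¹ • z ^ k) * X
      = ∑ p ∈ Finset.HasAntidiagonal.antidiagonal k,
        ((p.1.factorial : ℝ)⁻¹ • (adj z ^ p.1) X) * ((p.2.factorial : ℝ)⁻¹ • z ^ p.2) := by
  have hc : Commute (adj z) (LinearMap.mulRight ℝ z) := by
    refine LinearMap.ext fun X => ?_
    simp only [Module.End.mul_apply, adj_apply, LinearMap.mulRight_apply]
    noncomm_ring
  have h : (LinearMap.mulLeft ℝ z) ^ k = (adj z + LinearMap.mulRight ℝ z) ^ k := by simp [adj]
  have h2 := congrArg (fun f : Module.End ℝ A => (k.factorial : ℝ)⁻¹ • f X) (h.trans (hc.add_pow' k))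
  simp only [LinearMap.pow_mulLeft, LinearMap.mulLeft_apply] at h2
  rw [smul_mul_assoc, h2, LinearMap.sum_apply, Finset.smul_sum]
  refine Finset.sum_congr rfl fun p hp => ?_
  have hp' : p.1 + p.2 = k := Finset.HasAntidiagonal.mem_antidiagonal.mp hp
  have hcomm : (adj z ^ p.1 * LinearMap.mulRight ℝ z ^ p.2) X = (adj z ^ p.1) X * z ^ p.2 := by
    rw [(hc.pow_pow _ _).eq]
    simp [LinearMap.pow_mulRight]
  rw [LinearMap.smul_apply, hcomm, smul_mul_smul_comm, ← Nat.cast_smul_eq_nsmul ℝ, smul_smul]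
  congr 1
  have h3 := Nat.add_choose_mul_factorial_mul_factorial p.2 p.1
  rw [add_comm p.2, hp', mul_right_comm] at h3
  have h4 : (k.choose p.1 : ℝ) * p.1.factorial * p.2.factorial = k.factorial := by exact_mod_cast h3
  have a1 : (p.1.factorial : ℝ) ≠ 0 := by positivity
  have a2 : (p.2.factorial : ℝ) ≠ 0 := by positivity
  have a3 : (k.factorial : ℝ) ≠ 0 := by positivity
  field_simp
  linarith

/-- The derivative of a divided power under a derivation `D`. -/
theorem derivation_divPow_eq_sum (D : A →ₗ[ℝ] A) (hD : ∀ P Q, D (P * Q) = D P * Q + P * D Q)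
    (z : A) (k : ℕ) :
    D (((k + 1).factorial : ℝ)⁻¹ • z ^ (k + 1))
      = ∑ p ∈ Finset.HasAntidiagonal.antidiagonal k,
        (((p.1 + 1).factorial : ℝ)⁻¹ • (adj z ^ p.1) (D z)) * ((p.2.factorial : ℝ)⁻¹ • z ^ p.2) := by
  have hone : D 1 = 0 := by simpa using hD 1 1
  -- The plan is to use `divPow_mul_eq_sum` in the algebra of endomorphisms, for left multiplication
  -- by `z` and the operator `D`, and to evaluate at `1`. The Leibniz rule says that the commutator
  -- of the two is minus left multiplication by `D z`.
  have hleft : ∀ i Y, (adj (LinearMap.mulLeft ℝ z : Module.End ℝ A) ^ i) (LinearMap.mulLeft ℝ Y)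
      = LinearMap.mulLeft ℝ ((adj z ^ i) Y) := by
    intro i
    induction i with
    | zero => intro Y; rfl
    | succ i ih =>
      intro Y
      rw [pow_succ, Module.End.mul_apply, pow_succ, Module.End.mul_apply, ← ih]
      congr 1
      refine LinearMap.ext fun X => ?_
      simp [adj_apply, sub_mul, mul_assoc]
  have had : ∀ i, (adj (LinearMap.mulLeft ℝ z : Module.End ℝ A) ^ (i + 1)) D
      = -LinearMap.mulLeft ℝ ((adj z ^ i) (D z)) := by
    intro i
    have h1 : adj (LinearMap.mulLeft ℝ z : Module.End ℝ A) D = -LinearMap.mulLeft ℝ (D z) := by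
      refine LinearMap.ext fun X => ?_
      simp [adj_apply, hD]
    rw [pow_succ, Module.End.mul_apply, h1, map_neg, hleft]
  -- The left side vanishes because `D 1 = 0`; on the right the term without commutators is the
  -- derivative sought.
  have h := congrArg (fun f : Module.End ℝ A => f 1)
    (divPow_mul_eq_sum (LinearMap.mulLeft ℝ z : Module.End ℝ A) D (k + 1))
  simp only [Module.End.mul_apply, hone, map_zero, Finset.Nat.sum_antidiagonal_succ,
    LinearMap.add_apply, LinearMap.sum_apply, had] at h
  simp only [LinearMap.smul_apply, LinearMap.pow_mulLeft, LinearMap.mulLeft_apply, mul_one,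
    LinearMap.neg_apply, pow_zero, Module.End.one_apply, Nat.factorial_zero, Nat.cast_one,
    inv_one, one_smul, smul_neg, Finset.sum_neg_distrib] at h
  rw [eq_comm, ← sub_eq_add_neg, sub_eq_zero] at h
  rw [h]
  exact Finset.sum_congr rfl fun p _ => by rw [smul_mul_assoc]

end ad

namespace NC

variable {d : ℕ}

/-! ### Lie series -/

theorem letter_coef (i : Fin (d + 1)) (w : Word d) :
    coef w (mk (letter i)) = if w = [i] then 1 else 0 := rfl

theorem IsLiePolynomial.coef_nil {P : Series d} (h : IsLiePolynomial P) : coef [] (mk P) = 0 := by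
  induction h with
  | letter i => rw [letter_coef]; simp
  | zero => rfl
  | add _ _ h1 h2 =>
    rw [coef_mk] at *; simp [h1, h2]
  | smul c _ h => rw [coef_mk] at *; simp [h]
  | @bracket P Q _ _ h1 h2 =>
    change coef [] (mk P * mk Q - mk Q * mk P) = 0
    rw [map_sub, coef_nil_mul, coef_nil_mul, h1, h2]; simp

/-- The space of Lie polynomials. -/
def liePoly (d : ℕ) : Submodule ℝ (NC d) where
  carrier := {P | IsLiePolynomial P}
  add_mem' h h' := IsLiePolynomial.add h h'
  zero_mem' := IsLiePolynomial.zero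
  smul_mem' c _ h := IsLiePolynomial.smul c h

theorem adj_mem_liePoly {P Q : NC d} (hP : P ∈ liePoly d) (hQ : Q ∈ liePoly d) :
    adj P Q ∈ liePoly d := by
  rw [adj_apply]; exact IsLiePolynomial.bracket hP hQ

/-- The space of Lie series. -/
def lieSer (d : ℕ) : Submodule ℝ (NC d) where
  carrier := {P | ∀ k, cp k P ∈ liePoly d}
  add_mem' h h' k := by rw [map_add]; exact Submodule.add_mem _ (h k) (h' k)
  zero_mem' k := by rw [map_zero]; exact Submodule.zero_mem _
  smul_mem' c P h k := by rw [map_smul]; exact Submodule.smul_mem _ _ (h k)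

theorem isLieSeries_iff {P : Series d} : IsLieSeries P ↔ mk P ∈ lieSer d := by
  refine forall_congr' fun k => ?_
  rw [← mk_component]; rfl

theorem lieSer_le_fil : lieSer d ≤ fil d 1 := by
  intro P hP
  have := IsLiePolynomial.coef_nil (hP 0)
  rw [mem_fil_one, ← this]
  change _ = coef [] (cp 0 P)
  rw [coef_cp, if_pos weight_nil]

theorem adj_mem_lieSer {P Q : NC d} (hP : P ∈ lieSer d) (hQ : Q ∈ lieSer d) :
    adj P Q ∈ lieSer d := by
  intro k
  have : cp k (adj P Q) = ∑ p ∈ Finset.HasAntidiagonal.antidiagonal k, adj (cp p.1 P) (cp p.2 Q) := by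
    simp only [adj_apply, map_sub, cp_mul, Finset.sum_sub_distrib]
    congr 1
    rw [← Finset.Nat.sum_antidiagonal_swap]; rfl
  rw [this]
  exact Submodule.sum_mem _ fun p _ => adj_mem_liePoly (hP _) (hQ _)

theorem adj_pow_mem_lieSer {P Q : NC d} (hP : P ∈ lieSer d) (hQ : Q ∈ lieSer d) (i : ℕ) :
    (adj P ^ i) Q ∈ lieSer d := by
  induction i with
  | zero => exact hQ
  | succ i ih => rw [pow_succ', Module.End.mul_apply]; exact adj_mem_lieSer hP ih

theorem wt_mem_lieSer {P : NC d} (hP : P ∈ lieSer d) : wt P ∈ lieSer d := by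
  intro k; rw [cp_wt]; exact Submodule.smul_mem _ _ (hP k)

theorem tr_mem_lieSer {P : NC d} (hP : P ∈ lieSer d) (n : ℕ) : tr n P ∈ lieSer d := by
  intro k; rw [cp_tr]; split_ifs
  · exact hP k
  · exact Submodule.zero_mem _

theorem rs_mem_lieSer {P : NC d} (hP : P ∈ lieSer d) (t : ℝ) : rs t P ∈ lieSer d := by
  intro k; rw [cp_rs]; exact Submodule.smul_mem _ _ (hP k)

theorem mem_liePoly_of_mem_lieSer {P : NC d} (hP : P ∈ lieSer d) {n : ℕ} (hn : P ∈ poly d n) :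
    P ∈ liePoly d := by
  rw [← sum_cp hn]; exact Submodule.sum_mem _ fun k _ => hP k

theorem adj_mem_fil {i j : ℕ} {P Q : NC d} (hP : P ∈ fil d i) (hQ : Q ∈ fil d j) :
    adj P Q ∈ fil d (i + j) := by
  rw [adj_apply]
  exact Submodule.sub_mem _ (mul_mem_fil hP hQ) (add_comm i j ▸ mul_mem_fil hQ hP)

theorem adj_pow_mem_fil {j : ℕ} {P Q : NC d} (hP : P ∈ fil d 1) (hQ : Q ∈ fil d j) (i : ℕ) :
    (adj P ^ i) Q ∈ fil d (i + j) := by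
  induction i with
  | zero => simpa using hQ
  | succ i ih =>
    rw [pow_succ', Module.End.mul_apply]
    exact fil_anti (by omega) (adj_mem_fil hP ih)

/-! ### The Baker–Campbell–Hausdorff theorem -/

/-- `exp(z) H = (exp(ad z) H) exp(z)` up to order `n`. -/
theorem ex_mul_sub_mem_fil {z : NC d} (hz : z ∈ fil d 1) (H : NC d) (n : ℕ) :
    ex z * H - (∑ i ∈ Finset.range n, (i.factorial : ℝ)⁻¹ • (adj z ^ i) H) * ex z ∈ fil d n := by
  have h1 := mul_mem_fil_right (ex_sub_mem_fil hz n) H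
  have h2 := mul_mem_fil_left (∑ i ∈ Finset.range n, (i.factorial : ℝ)⁻¹ • (adj z ^ i) H)
    (ex_sub_mem_fil hz n)
  have h3 := sum_mul_sum_sub_mem_fil
    (a := fun i => (i.factorial : ℝ)⁻¹ • (adj z ^ i) H) (b := fun i => (i.factorial : ℝ)⁻¹ • z ^ i)
    (fun i => Submodule.smul_mem _ _ (by simpa using adj_pow_mem_fil hz (mem_fil_zero H) i))
    (fun i => Submodule.smul_mem _ _ (pow_mem_fil hz i)) n
  -- The terms of the Cauchy product are the divided powers of `z` times `H`, so both sides now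
  -- differ only by truncation errors.
  simp only [← divPow_mul_eq_sum, ← Finset.sum_mul] at h3
  convert Submodule.sub_mem _ (Submodule.sub_mem _ h1 h2) h3 using 1
  noncomm_ring

/-- The logarithmic derivative of `exp(z)` up to order `n`. -/
theorem wt_ex_sub_mem_fil {z : NC d} (hz : z ∈ fil d 1) (n : ℕ) :
    wt (ex z) - (∑ i ∈ Finset.range n, ((i + 1).factorial : ℝ)⁻¹ • (adj z ^ i) (wt z)) * ex z
      ∈ fil d n := by
  -- One term more than in `h2`: `wt` kills the constant term, and the remaining divided powers have
  -- exponents `1, …, n`.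
  have h1 := wt_mem_fil (ex_sub_mem_fil hz (n + 1))
  have h2 := mul_mem_fil_left
    (∑ i ∈ Finset.range n, ((i + 1).factorial : ℝ)⁻¹ • (adj z ^ i) (wt z)) (ex_sub_mem_fil hz n)
  have h3 := sum_mul_sum_sub_mem_fil
    (a := fun i => ((i + 1).factorial : ℝ)⁻¹ • (adj z ^ i) (wt z))
    (b := fun i => (i.factorial : ℝ)⁻¹ • z ^ i)
    (fun i => Submodule.smul_mem _ _
      (by simpa using adj_pow_mem_fil hz (mem_fil_zero (wt z)) i))
    (fun i => Submodule.smul_mem _ _ (pow_mem_fil hz i)) n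
  simp only [← derivation_divPow_eq_sum wt wt_mul] at h3
  rw [Finset.sum_range_succ', map_sub, map_add, map_sum] at h1
  have hone : wt (((Nat.factorial 0 : ℕ) : ℝ)⁻¹ • z ^ 0) = 0 := by
    simpa using wt_mul (1 : NC d) 1
  rw [hone, add_zero] at h1
  convert Submodule.sub_mem _ (Submodule.sub_mem _ (fil_anti (Nat.le_succ n) h1) h2) h3 using 1
  noncomm_ring

/-- The product `exp(z_1) ⋯ exp(z_n)`. -/
def expProd (l : List (NC d)) : NC d := (l.map ex).prod

theorem bch_eq (l : List (Series d)) : mk (bch l) = lg (expProd (l.map mk)) := by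
  have : mk ((l.map sExp).foldr sMul (sOne d)) = expProd (l.map mk) := by
    induction l with
    | nil => rfl
    | cons a l ih =>
      have e : expProd ((a :: l).map mk) = ex (mk a) * expProd (l.map mk) := by simp [expProd]
      rw [e, ← ih]; rfl
  rw [← this]; rfl

theorem expProd_sub_one_mem_fil {l : List (NC d)} (hl : ∀ z ∈ l, z ∈ fil d 1) :
    expProd l - 1 ∈ fil d 1 := by
  induction l with
  | nil => simp [expProd]
  | cons a l ih =>
    have h1 := ex_sub_one_mem_fil (hl a (by simp))
    have h2 := ih fun z hz => hl z (by simp [hz])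
    have := mul_sub_mul_mem_fil h1 h2
    simpa [expProd] using this

/-- By the Leibniz rule, if `P` has logarithmic derivative `H`, then `exp(z) P` has that of `exp(z)`
plus `exp(ad z) H`. Both are sums of iterated commutators of Lie series. -/
theorem exists_wt_expProd {l : List (NC d)} (hl : ∀ z ∈ l, z ∈ lieSer d) (n : ℕ) :
    ∃ H ∈ lieSer d, wt (expProd l) - H * expProd l ∈ fil d n := by
  induction l with
  | nil =>
    refine ⟨0, Submodule.zero_mem _, ?_⟩
    have : wt (1 : NC d) = 0 := by simpa using wt_mul (1 : NC d) 1
    simp [expProd, this]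
  | cons z l ih =>
    obtain ⟨H, hH, hHl⟩ := ih fun z hz => hl z (by simp [hz])
    have hz : z ∈ lieSer d := hl z (by simp)
    have hz1 := lieSer_le_fil hz
    set G := ∑ i ∈ Finset.range n, ((i + 1).factorial : ℝ)⁻¹ • (adj z ^ i) (wt z) with hG
    set H' := ∑ i ∈ Finset.range n, (i.factorial : ℝ)⁻¹ • (adj z ^ i) H with hH'
    refine ⟨G + H', Submodule.add_mem _ ?_ ?_, ?_⟩
    · exact Submodule.sum_mem _ fun i _ => Submodule.smul_mem _ _
        (adj_pow_mem_lieSer hz (wt_mem_lieSer hz) i)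
    · exact Submodule.sum_mem _ fun i _ => Submodule.smul_mem _ _ (adj_pow_mem_lieSer hz hH i)
    · have e : expProd (z :: l) = ex z * expProd l := by simp [expProd]
      have h1 := mul_mem_fil_right (wt_ex_sub_mem_fil hz1 n) (expProd l)
      have h2 := mul_mem_fil_left (ex z) hHl
      have h3 := mul_mem_fil_right (ex_mul_sub_mem_fil hz1 H n) (expProd l)
      rw [e, wt_mul]
      convert Submodule.add_mem _ (Submodule.add_mem _ h1 h2) h3 using 1
      rw [← hG, ← hH']
      noncomm_ring

/-- Since `X Q - X = X (Q - 1)` has one order more than `X`, the order of `X` can be raised step by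
step up to `n`. -/
theorem mem_fil_of_mul_mem_fil {n : ℕ} {X Q : NC d} (hQ : Q - 1 ∈ fil d 1)
    (h : X * Q ∈ fil d n) : X ∈ fil d n := by
  have : ∀ j ≤ n, X ∈ fil d j := by
    intro j
    induction j with
    | zero => intro _; exact mem_fil_zero X
    | succ j ih =>
      intro hj
      have h1 := mul_mem_fil (ih (by omega)) hQ
      have h2 := Submodule.sub_mem _ (fil_anti hj h) h1
      convert h2 using 1
      noncomm_ring
  exact this n le_rfl

/-- Each commutator with a series of order one gains an order. Thus in genuine commutators the part
of `L` of weight `k` is invisible at weight `k`, which makes the induction for the Lie property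
possible. -/
theorem adj_pow_sub_mem_fil {k : ℕ} {L L' : NC d} (hL : L ∈ fil d 1)
    (hL' : L' ∈ fil d 1) (h : L - L' ∈ fil d k) (i : ℕ) :
    (adj L ^ (i + 1)) (wt L) - (adj L' ^ (i + 1)) (wt L') ∈ fil d (k + 1) := by
  have step : ∀ {X X' : NC d}, X ∈ fil d 1 → X - X' ∈ fil d k →
      adj L X - adj L' X' ∈ fil d (k + 1) := by
    intro X X' hX hXX'
    have e : adj L X - adj L' X' = adj (L - L') X + adj L' (X - X') := by
      simp only [adj_apply]; noncomm_ring
    rw [e]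
    exact Submodule.add_mem _ (adj_mem_fil h hX) (add_comm k 1 ▸ adj_mem_fil hL' hXX')
  have mem1 : ∀ i, (adj L ^ i) (wt L) ∈ fil d 1 := fun i =>
    fil_anti (by omega) (adj_pow_mem_fil hL (wt_mem_fil hL) i)
  induction i with
  | zero =>
    simp only [zero_add, pow_one]
    exact step (wt_mem_fil hL) (by rw [← map_sub]; exact wt_mem_fil h)
  | succ i ih =>
    rw [pow_succ' (adj L) (i + 1), pow_succ' (adj L') (i + 1), Module.End.mul_apply,
      Module.End.mul_apply]
    exact step (mem1 _) (fil_anti (Nat.le_succ k) ih)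

/-- A series whose exponential has a Lie series as logarithmic derivative is a Lie series. -/
theorem mem_lieSer_of_wt_ex {L : NC d} (hL : L ∈ fil d 1)
    (h : ∀ n, ∃ H ∈ lieSer d, wt (ex L) - H * ex L ∈ fil d n) : L ∈ lieSer d := by
  intro k
  induction k using Nat.strong_induction_on with
  | _ k ih =>
    rcases Nat.eq_zero_or_pos k with rfl | hk
    · rw [cp_eq_zero_of_mem_fil Nat.zero_lt_one hL]; exact Submodule.zero_mem _
    obtain ⟨H, hH, hHL⟩ := h (k + 1)
    set G := ∑ i ∈ Finset.range (k + 1), ((i + 1).factorial : ℝ)⁻¹ • (adj L ^ i) (wt L) with hG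
    -- `H` and `G` are both logarithmic derivatives of `ex L` up to this order, and the factor `ex
    -- L` can be cancelled.
    have h1 : H - G ∈ fil d (k + 1) := by
      refine mem_fil_of_mul_mem_fil (ex_sub_one_mem_fil hL) ?_
      convert Submodule.sub_mem _ (wt_ex_sub_mem_fil hL (k + 1)) hHL using 1
      rw [← hG]; noncomm_ring
    set L' := tr (k - 1) L with hL'
    have hL'Lie : L' ∈ lieSer d := by
      intro j; rw [hL', cp_tr]; split_ifs with hj
      · exact ih j (by omega)
      · exact Submodule.zero_mem _
    have hLL' : L - L' ∈ fil d k := by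
      have := sub_tr_mem_fil (k - 1) L
      rwa [Nat.sub_add_cancel hk] at this
    -- The genuine commutators involve only `L'`, already known to be Lie; the part of weight `k` of
    -- `L` enters through the linear term `wt L` alone, with the factor `k`, which is invertible.
    have h2 : cp k G = ∑ i ∈ Finset.range k,
        ((i + 2).factorial : ℝ)⁻¹ • cp k ((adj L' ^ (i + 1)) (wt L')) + (k : ℝ) • cp k L := by
      rw [hG, Finset.sum_range_succ', map_add, map_sum]
      congr 1
      · refine Finset.sum_congr rfl fun i _ => ?_
        rw [map_smul, cp_eq_of_sub_mem (Nat.lt_succ_self k)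
          (adj_pow_sub_mem_fil hL (lieSer_le_fil hL'Lie) hLL' i)]
      · simp [cp_wt]
    have h3 : (k : ℝ) • cp k L ∈ liePoly d := by
      have h4 : (k : ℝ) • cp k L = cp k H - ∑ i ∈ Finset.range k,
          ((i + 2).factorial : ℝ)⁻¹ • cp k ((adj L' ^ (i + 1)) (wt L')) := by
        rw [cp_eq_of_sub_mem (Nat.lt_succ_self k) h1, h2]; abel
      rw [h4]
      refine Submodule.sub_mem _ (hH k) (Submodule.sum_mem _ fun i _ => Submodule.smul_mem _ _ ?_)
      exact adj_pow_mem_lieSer hL'Lie (wt_mem_lieSer hL'Lie) (i + 1) k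
    have hk0 : (k : ℝ) ≠ 0 := by positivity
    simpa [smul_smul, hk0] using Submodule.smul_mem _ ((k : ℝ)⁻¹) h3

theorem lg_expProd_mem_lieSer {l : List (NC d)} (hl : ∀ z ∈ l, z ∈ lieSer d) :
    lg (expProd l) ∈ lieSer d := by
  have h1 := expProd_sub_one_mem_fil fun z hz => lieSer_le_fil (hl z hz)
  refine mem_lieSer_of_wt_ex (lg_mem_fil h1) fun n => ?_
  rw [ex_lg h1]
  exact exists_wt_expProd hl n

end NC

/-! ### Smooth bounded vector fields -/

/-- The Euclidean space `ℝ^N`. -/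
abbrev Euc (N : ℕ) : Type := EuclideanSpace ℝ (Fin N)

section Cb

variable {N : ℕ}

theorem IsCbSmooth.zero : IsCbSmooth (0 : Euc N → Euc N) := by
  refine ⟨contDiff_const, fun n => ⟨0, fun x => ?_⟩⟩
  rw [show (0 : Euc N → Euc N) = fun _ => 0 from rfl, iteratedFDeriv_fun_zero]; simp

theorem IsCbSmooth.sum_smul {ι : Type*} (S : Finset ι) (c : ι → ℝ) {F : ι → Euc N → Euc N}
    (hF : ∀ i ∈ S, IsCbSmooth (F i)) : IsCbSmooth (fun x => ∑ i ∈ S, c i • F i x) := by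
  refine ⟨ContDiff.sum fun i hi => (hF i hi).1.const_smul (c i), fun n => ?_⟩
  choose! K hK using fun i (hi : i ∈ S) => (hF i hi).2 n
  refine ⟨∑ i ∈ S, |c i| * K i, fun x => ?_⟩
  have hs : ∀ i ∈ S, ContDiffAt ℝ n (F i) x := fun i hi =>
    ((hF i hi).1.of_le (mod_cast le_top)).contDiffAt
  rw [iteratedFDeriv_fun_sum_apply fun i hi => (hs i hi).const_smul (c i)]
  refine (norm_sum_le _ _).trans (Finset.sum_le_sum fun i hi => ?_)
  rw [iteratedFDeriv_const_smul_apply' (hs i hi), norm_smul, Real.norm_eq_abs]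
  exact mul_le_mul_of_nonneg_left (hK i hi x) (abs_nonneg _)

theorem IsCbSmooth.derivAlong {U f : Euc N → Euc N} (hU : IsCbSmooth U) (hf : IsCbSmooth f) :
    IsCbSmooth (derivAlong U f) := by
  have hf' : ContDiff ℝ ((⊤ : ℕ∞) : WithTop ℕ∞) (fderiv ℝ f) :=
    hf.1.fderiv_right (by simp)
  refine ⟨hf'.clm_apply hU.1, fun n => ?_⟩
  choose KU hKU using hU.2
  choose Kf hKf using hf.2
  refine ⟨∑ i ∈ Finset.range (n + 1), (n.choose i : ℝ) * Kf (i + 1) * KU (n - i), fun x => ?_⟩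
  refine (norm_iteratedFDeriv_clm_apply (N := ((⊤ : ℕ∞) : WithTop ℕ∞)) hf'
    hU.1 x (mod_cast le_top)).trans (Finset.sum_le_sum fun i _ => ?_)
  rw [norm_iteratedFDeriv_fderiv]
  have h1 : 0 ≤ Kf (i + 1) := (norm_nonneg _).trans (hKf _ x)
  gcongr
  · exact hKf _ x
  · exact hKU _ x

theorem IsCbSmooth.bddAbove {W : Euc N → Euc N} (hW : IsCbSmooth W) (i : ℕ) :
    BddAbove (Set.range fun x => ‖iteratedFDeriv ℝ i W x‖) := by
  obtain ⟨K, hK⟩ := hW.2 i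
  exact ⟨K, by rintro _ ⟨x, rfl⟩; exact hK x⟩

theorem cNorm_nonneg (n : ℕ) (W : Euc N → Euc N) : 0 ≤ cNorm n W :=
  Finset.sum_nonneg fun _ _ => Real.iSup_nonneg fun _ => norm_nonneg _

theorem IsCbSmooth.norm_iteratedFDeriv_le_cNorm {W : Euc N → Euc N} (hW : IsCbSmooth W) {i n : ℕ}
    (hi : i ≤ n) (x : Euc N) : ‖iteratedFDeriv ℝ i W x‖ ≤ cNorm n W :=
  (le_ciSup (hW.bddAbove i) x).trans
    (Finset.single_le_sum (f := fun i => ⨆ x, ‖iteratedFDeriv ℝ i W x‖)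
      (fun _ _ => Real.iSup_nonneg fun _ => norm_nonneg _) (Finset.mem_range.mpr (by omega)))

theorem IsCbSmooth.norm_le_cNorm {W : Euc N → Euc N} (hW : IsCbSmooth W) (n : ℕ) (x : Euc N) :
    ‖W x‖ ≤ cNorm n W := by
  simpa using hW.norm_iteratedFDeriv_le_cNorm (Nat.zero_le n) x

theorem cNorm_sum_smul_le {ι : Type*} (S : Finset ι) (c : ι → ℝ) {F : ι → Euc N → Euc N}
    (hF : ∀ i ∈ S, IsCbSmooth (F i)) (n : ℕ) :
    cNorm n (fun x => ∑ i ∈ S, c i • F i x) ≤ ∑ i ∈ S, |c i| * cNorm n (F i) := by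
  simp only [cNorm, Finset.mul_sum]
  rw [Finset.sum_comm]
  refine Finset.sum_le_sum fun k _ => ciSup_le fun x => ?_
  have hs : ∀ i ∈ S, ContDiffAt ℝ k (F i) x := fun i hi =>
    ((hF i hi).1.of_le (mod_cast le_top)).contDiffAt
  rw [iteratedFDeriv_fun_sum_apply fun i hi => (hs i hi).const_smul (c i)]
  refine (norm_sum_le _ _).trans (Finset.sum_le_sum fun i hi => ?_)
  rw [iteratedFDeriv_const_smul_apply' (hs i hi), norm_smul, Real.norm_eq_abs]
  exact mul_le_mul_of_nonneg_left (le_ciSup ((hF i hi).bddAbove k) x) (abs_nonneg _)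

theorem IsCbSmooth.lipschitzWith {W : Euc N → Euc N} (hW : IsCbSmooth W) {n : ℕ} (hn : 1 ≤ n) :
    LipschitzWith (cNorm n W).toNNReal W := by
  refine lipschitzWith_of_nnnorm_fderiv_le (𝕜 := ℝ) (hW.1.differentiable (by simp)) fun x => ?_
  rw [← norm_toNNReal]
  refine Real.toNNReal_le_toNNReal ?_
  rw [← norm_iteratedFDeriv_one]
  exact hW.norm_iteratedFDeriv_le_cNorm hn x

end Cb

/-! ### The differential operators of words and polynomials -/

section phi

open NC

variable {N d : ℕ}

/-- Infinitely differentiable maps of the Euclidean space. -/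
abbrev Smooth (f : Euc N → Euc N) : Prop := ContDiff ℝ ((⊤ : ℕ∞) : WithTop ℕ∞) f

theorem Smooth.derivAlong {U f : Euc N → Euc N} (hU : Smooth U) (hf : Smooth f) :
    Smooth (derivAlong U f) :=
  (hf.fderiv_right (m := ((⊤ : ℕ∞) : WithTop ℕ∞)) (by simp)).clm_apply hU

variable {V : Fin (d + 1) → Euc N → Euc N}

theorem Smooth.wordOp (hV : ∀ i, Smooth (V i)) (w : Word d) {f : Euc N → Euc N} (hf : Smooth f) :
    Smooth (wordOp V w f) := by
  induction w with
  | nil => exact hf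
  | cons i w ih => exact Smooth.derivAlong (hV i) ih

theorem wordOp_append (u v : Word d) (f : Euc N → Euc N) :
    wordOp V (u ++ v) f = wordOp V u (wordOp V v f) := by
  simp [wordOp, List.foldr_append]

theorem wordOp_sum_smul (hV : ∀ i, Smooth (V i)) (w : Word d) {ι : Type*} (S : Finset ι)
    (c : ι → ℝ) {F : ι → Euc N → Euc N} (hF : ∀ i ∈ S, Smooth (F i)) :
    wordOp V w (fun x => ∑ i ∈ S, c i • F i x) = fun x => ∑ i ∈ S, c i • wordOp V w (F i) x := by
  induction w with
  | nil => rfl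
  | cons a w ih =>
    funext x
    change fderiv ℝ (wordOp V w fun x => ∑ i ∈ S, c i • F i x) x (V a x) = _
    have hd : ∀ i ∈ S, DifferentiableAt ℝ (wordOp V w (F i)) x := fun i hi =>
      ((Smooth.wordOp hV w (hF i hi)).differentiable (by simp)) x
    rw [ih, fderiv_fun_sum fun i hi => (hd i hi).fun_const_smul (c i), sum_apply]
    refine Finset.sum_congr rfl fun i hi => ?_
    rw [fderiv_fun_const_smul (hd i hi)]; rfl

/-- The empty word is excluded because it yields the identity map, in general unbounded. -/
theorem IsCbSmooth.wordOp_id (hV : ∀ i, IsCbSmooth (V i)) {w : Word d} (hw : w ≠ []) :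
    IsCbSmooth (wordOp V w (id : Euc N → Euc N)) := by
  induction w with
  | nil => exact absurd rfl hw
  | cons i w ih =>
    rcases eq_or_ne w [] with rfl | h
    · have : wordOp V [i] (id : Euc N → Euc N) = V i := by
        funext x; simp [wordOp, KRK.derivAlong]
      rw [this]; exact hV i
    · exact (hV i).derivAlong (ih h)

theorem phiOp_eq_sum {n : ℕ} {P : NC d} (hP : P ∈ poly d n) (f : Euc N → Euc N) :
    phiOp V P f = fun x => ∑ w ∈ wordsLE d n, coef w P • wordOp V w f x := by
  funext x
  refine finsum_eq_sum_of_support_subset _ fun w hw => ?_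
  rw [Finset.mem_coe, mem_wordsLE]
  by_contra h
  refine hw ?_
  change coef w P • _ = _
  rw [hP w (by omega), zero_smul]

theorem Smooth.phiOp (hV : ∀ i, Smooth (V i)) {n : ℕ} {P : NC d} (hP : P ∈ poly d n) {f : Euc N → Euc N}
    (hf : Smooth f) : Smooth (phiOp V P f) := by
  rw [phiOp_eq_sum hP]
  exact ContDiff.sum fun w _ => (Smooth.wordOp hV w hf).const_smul _

theorem phiOp_add {n : ℕ} {P Q : NC d} (hP : P ∈ poly d n) (hQ : Q ∈ poly d n) (f : Euc N → Euc N) :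
    phiOp V (P + Q : NC d) f = phiOp V P f + phiOp V Q f := by
  rw [phiOp_eq_sum hP, phiOp_eq_sum hQ, phiOp_eq_sum (Submodule.add_mem _ hP hQ)]
  funext x
  simp [add_smul, Finset.sum_add_distrib]

theorem phiOp_smul {n : ℕ} {P : NC d} (hP : P ∈ poly d n) (c : ℝ) (f : Euc N → Euc N) :
    phiOp V (c • P : NC d) f = c • phiOp V P f := by
  rw [phiOp_eq_sum hP, phiOp_eq_sum (Submodule.smul_mem _ c hP)]
  funext x
  simp [mul_smul, Finset.smul_sum]

theorem phiOp_zero (f : Euc N → Euc N) : phiOp V (0 : NC d) f = 0 := by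
  have := phiOp_smul (V := V) (Submodule.zero_mem (poly d 0)) 0 f
  simpa using this

theorem phiOp_sub {n : ℕ} {P Q : NC d} (hP : P ∈ poly d n) (hQ : Q ∈ poly d n) (f : Euc N → Euc N) :
    phiOp V (P - Q : NC d) f = phiOp V P f - phiOp V Q f := by
  rw [sub_eq_add_neg, ← neg_one_smul ℝ Q, phiOp_add hP (Submodule.smul_mem _ _ hQ), phiOp_smul hQ]
  simp [sub_eq_add_neg]

theorem phiOp_sum {n : ℕ} {ι : Type*} (S : Finset ι) {P : ι → NC d} (hP : ∀ i ∈ S, P i ∈ poly d n)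
    (f : Euc N → Euc N) : phiOp V (∑ i ∈ S, P i : NC d) f = ∑ i ∈ S, phiOp V (P i) f := by
  classical
  induction S using Finset.induction_on with
  | empty => simp [phiOp_zero]
  | insert a S ha ih =>
    rw [Finset.sum_insert ha, Finset.sum_insert ha,
      phiOp_add (hP a (by simp)) (Submodule.sum_mem _ fun i hi => hP i (by simp [hi])),
      ih fun i hi => hP i (by simp [hi])]

theorem phiOp_one (f : Euc N → Euc N) : phiOp V (1 : NC d) f = f := by
  rw [phiOp_eq_sum (one_mem_poly 0)]
  funext x
  rw [Finset.sum_eq_single []]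
  · simp [coef_one, wordOp]
  · intro w _ hw; simp [coef_one, hw]
  · intro h; exact absurd (mem_wordsLE.mpr (by simp [weight_nil])) h

/-- A word as a series. -/
def single (u : Word d) : NC d := NC.mk fun w => if w = u then 1 else 0

theorem coef_single (u w : Word d) : coef w (single u) = if w = u then 1 else 0 := rfl

theorem single_mem_poly {u : Word d} {n : ℕ} (h : weight u ≤ n) : single u ∈ poly d n := by
  intro w hw
  rw [coef_single, if_neg]
  rintro rfl; omega

theorem single_mul_single (u v : Word d) : single u * single v = single (u ++ v) := by
  ext w
  induction u generalizing w with
  | nil =>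
    have : (single [] : NC d) = 1 := rfl
    rw [this, one_mul]; rfl
  | cons a u ih =>
    cases w with
    | nil => simp [coef_nil_mul, coef_single]
    | cons b w =>
      rw [coef_cons_mul]
      by_cases h : b = a
      · subst h
        have ht : NC.tail b (single (b :: u)) = single u := by
          ext v; simp [coef_single]
        rw [ht, ih]; simp [coef_single]
      · have ht : NC.tail b (single (a :: u)) = 0 := by
          ext v; simp [coef_single, h]
        rw [ht, zero_mul]; simp [coef_single, h]

theorem sum_single {n : ℕ} {P : NC d} (hP : P ∈ poly d n) :
    P = ∑ u ∈ wordsLE d n, coef u P • single u := by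
  ext w
  simp only [map_sum, map_smul, coef_single, smul_eq_mul, mul_ite, mul_one, mul_zero,
    Finset.sum_ite_eq, mem_wordsLE]
  split_ifs with h
  · rfl
  · rw [hP w (by omega)]

theorem phiOp_single (u : Word d) (f : Euc N → Euc N) : phiOp V (single u) f = wordOp V u f := by
  rw [phiOp_eq_sum (single_mem_poly le_rfl)]
  funext x
  rw [Finset.sum_eq_single u]
  · simp [coef_single]
  · intro w _ hw; simp [coef_single, hw]
  · intro h; exact absurd (mem_wordsLE.mpr le_rfl) h

theorem phiOp_mul (hV : ∀ i, Smooth (V i)) {i j : ℕ} {P Q : NC d} (hP : P ∈ poly d i)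
    (hQ : Q ∈ poly d j) {f : Euc N → Euc N} (hf : Smooth f) :
    phiOp V (P * Q : NC d) f = phiOp V P (phiOp V Q f) := by
  have h : P * Q = ∑ u ∈ wordsLE d i, ∑ v ∈ wordsLE d j,
      (coef u P * coef v Q) • single (u ++ v) := by
    conv_lhs => rw [sum_single hP, sum_single hQ]
    rw [Finset.sum_mul_sum]
    refine Finset.sum_congr rfl fun u _ => Finset.sum_congr rfl fun v _ => ?_
    rw [smul_mul_smul_comm, single_mul_single]
  have hmem : ∀ u ∈ wordsLE d i, ∀ v ∈ wordsLE d j, single (u ++ v) ∈ poly d (i + j) := by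
    intro u hu v hv
    refine single_mem_poly ?_
    rw [weight_append]
    exact add_le_add (mem_wordsLE.mp hu) (mem_wordsLE.mp hv)
  rw [h, phiOp_sum (n := i + j) _ fun u hu => Submodule.sum_mem _ fun v hv =>
    Submodule.smul_mem _ _ (hmem u hu v hv)]
  rw [phiOp_eq_sum hP, phiOp_eq_sum hQ]
  funext x
  rw [Finset.sum_apply]
  refine Finset.sum_congr rfl fun u hu => ?_
  rw [phiOp_sum (n := i + j) _ fun v hv => Submodule.smul_mem _ _ (hmem u hu v hv),
    wordOp_sum_smul hV u _ _ fun v _ => Smooth.wordOp hV v hf, Finset.sum_apply, Finset.smul_sum]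
  refine Finset.sum_congr rfl fun v hv => ?_
  rw [phiOp_smul (hmem u hu v hv), phiOp_single, wordOp_append, Pi.smul_apply, mul_smul]

theorem derivAlong_derivAlong {U W f : Euc N → Euc N} (hW : Smooth W) (hf : Smooth f) (x : Euc N) :
    derivAlong U (derivAlong W f) x
      = fderiv ℝ f x (fderiv ℝ W x (U x)) + fderiv ℝ (fderiv ℝ f) x (U x) (W x) := by
  have h1 : DifferentiableAt ℝ (fderiv ℝ f) x :=
    ((hf.fderiv_right (m := ((⊤ : ℕ∞) : WithTop ℕ∞)) (by simp)).differentiable (by simp)) x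
  have h2 : DifferentiableAt ℝ W x := (hW.differentiable (by simp)) x
  change fderiv ℝ (fun y => fderiv ℝ f y (W y)) x (U x) = _
  rw [fderiv_clm_apply h1 h2]
  simp

/-- The second-order terms cancel by the symmetry of the second derivative of `f`. -/
theorem derivAlong_bracket {U W f : Euc N → Euc N} (hU : Smooth U) (hW : Smooth W) (hf : Smooth f) :
    derivAlong U (derivAlong W f) - derivAlong W (derivAlong U f)
      = derivAlong (derivAlong U W - derivAlong W U) f := by
  funext x
  have hsymm : IsSymmSndFDerivAt ℝ f x :=
    hf.contDiffAt.isSymmSndFDerivAt (by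
      rw [minSmoothness_of_isRCLikeNormedField]
      exact WithTop.coe_le_coe.mpr (le_top : (2 : ℕ∞) ≤ ⊤))
  rw [Pi.sub_apply, derivAlong_derivAlong hW hf, derivAlong_derivAlong hU hf, hsymm (W x) (U x)]
  simp [derivAlong]

/-- First-order operators are closed under brackets, so induction over Lie polynomials applies. The
weight bound is carried along because `phiOp` is handled as a finite sum, and is linear and
multiplicative, only on polynomials. -/
theorem liePoly_phiOp (hV : ∀ i, Smooth (V i)) {P : NC d} (hP : P ∈ liePoly d) :
    (∃ n, P ∈ poly d n) ∧
      ∀ f : Euc N → Euc N, Smooth f → phiOp V P f = derivAlong (phiField V P) f := by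
  change IsLiePolynomial P at hP
  induction hP with
  | letter i =>
    have e : KRK.letter i = (single [i] : NC d) := rfl
    refine ⟨⟨weight [i], single_mem_poly le_rfl⟩, fun f _ => ?_⟩
    rw [phiField, e, phiOp_single, phiOp_single]
    funext x; simp [wordOp, derivAlong]
  | zero =>
    refine ⟨⟨0, Submodule.zero_mem _⟩, fun f _ => ?_⟩
    have h : ∀ f : Euc N → Euc N, phiOp V (0 : Series d) f = 0 := phiOp_zero
    rw [phiField, h, h]
    funext x; simp [derivAlong]
  | @add P Q _ _ h1 h2 =>
    obtain ⟨⟨n1, hn1⟩, h1⟩ := h1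
    obtain ⟨⟨n2, hn2⟩, h2⟩ := h2
    have hn1' := poly_mono (le_max_left n1 n2) hn1
    have hn2' := poly_mono (le_max_right n1 n2) hn2
    have h : ∀ f : Euc N → Euc N, phiOp V (P + Q : Series d) f = phiOp V P f + phiOp V Q f :=
      phiOp_add hn1' hn2'
    refine ⟨⟨_, Submodule.add_mem _ hn1' hn2'⟩, fun f hf => ?_⟩
    rw [phiField, h, h, h1 f hf, h2 f hf]
    funext x; simp [derivAlong, phiField]
  | @smul c P _ h1 =>
    obtain ⟨⟨n1, hn1⟩, h1⟩ := h1
    have h : ∀ f : Euc N → Euc N, phiOp V (c • P : Series d) f = c • phiOp V P f := phiOp_smul hn1 c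
    refine ⟨⟨_, Submodule.smul_mem _ c hn1⟩, fun f hf => ?_⟩
    rw [phiField, h, h, h1 f hf]
    funext x; simp [derivAlong, phiField]
  | @bracket P Q _ _ h1 h2 =>
    obtain ⟨⟨n1, hn1⟩, h1⟩ := h1
    obtain ⟨⟨n2, hn2⟩, h2⟩ := h2
    have h12 := mul_mem_poly hn1 hn2
    have h21 := mul_mem_poly hn2 hn1
    rw [add_comm] at h21
    have hid : Smooth (id : Euc N → Euc N) := contDiff_id
    have hU : Smooth (phiField V P) := Smooth.phiOp hV hn1 hid
    have hW : Smooth (phiField V Q) := Smooth.phiOp hV hn2 hid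
    have h : ∀ f : Euc N → Euc N, Smooth f → phiOp V (sBracket P Q) f
        = derivAlong (phiField V P) (derivAlong (phiField V Q) f)
          - derivAlong (phiField V Q) (derivAlong (phiField V P) f) := by
      intro f hf
      have e := phiOp_sub (V := V) h12 h21 f
      rw [phiOp_mul hV hn1 hn2 hf, phiOp_mul hV hn2 hn1 hf, h1 _ (Smooth.phiOp hV hn2 hf),
        h2 _ (Smooth.phiOp hV hn1 hf), h1 f hf, h2 f hf] at e
      exact e
    have hi : ∀ U : Euc N → Euc N, derivAlong U id = U := by intro U; funext x; simp [derivAlong]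
    refine ⟨⟨_, Submodule.sub_mem _ h12 h21⟩, fun f hf => ?_⟩
    have hf2 : phiField V (sBracket P Q)
        = derivAlong (phiField V P) (phiField V Q) - derivAlong (phiField V Q) (phiField V P) := by
      rw [phiField, h id hid, hi, hi]
    rw [h f hf, hf2, derivAlong_bracket hU hW hf]

/-! ### Size of polynomials -/

/-- The `ℓ¹` norm of the terms of weight at most `n`. -/
def l1 (n : ℕ) (P : NC d) : ℝ := ∑ w ∈ wordsLE d n, |coef w P|

theorem l1_nonneg (n : ℕ) (P : NC d) : 0 ≤ l1 n P := Finset.sum_nonneg fun _ _ => abs_nonneg _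

theorem l1_add_le (n : ℕ) (P Q : NC d) : l1 n (P + Q) ≤ l1 n P + l1 n Q := by
  simp only [l1, ← Finset.sum_add_distrib, map_add]
  exact Finset.sum_le_sum fun _ _ => abs_add_le _ _

theorem l1_smul (n : ℕ) (c : ℝ) (P : NC d) : l1 n (c • P) = |c| * l1 n P := by
  simp [l1, abs_mul, Finset.mul_sum]

theorem l1_sub_le (n : ℕ) (P Q : NC d) : l1 n (P - Q) ≤ l1 n P + l1 n Q := by
  have := l1_add_le n P ((-1 : ℝ) • Q)
  rw [l1_smul] at this
  simpa [sub_eq_add_neg] using this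

theorem l1_sum_le (n : ℕ) {ι : Type*} (S : Finset ι) (P : ι → NC d) :
    l1 n (∑ i ∈ S, P i) ≤ ∑ i ∈ S, l1 n (P i) := by
  refine Finset.le_sum_of_subadditive (l1 n) ?_ (l1_add_le n) S P
  simp [l1]

theorem l1_one (n : ℕ) : l1 n (1 : NC d) = 1 := by
  rw [l1, Finset.sum_eq_single []]
  · simp [coef_one]
  · intro w _ hw; simp [coef_one, hw]
  · intro h; exact absurd (mem_wordsLE.mpr (by simp [weight_nil])) h

/-- A word with a cutting point is determined by its prefix and suffix, and neither exceeds the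
weight of the word; the terms of the product are thus distinct terms of the double sum. -/
theorem l1_mul_le (n : ℕ) (P Q : NC d) : l1 n (P * Q) ≤ l1 n P * l1 n Q := by
  classical
  have h1 : l1 n (P * Q) ≤ ∑ w ∈ wordsLE d n, ∑ k ∈ Finset.range (w.length + 1),
      |coef (w.take k) P| * |coef (w.drop k) Q| := by
    refine Finset.sum_le_sum fun w _ => ?_
    rw [coef_mul]
    refine (Finset.abs_sum_le_sum_abs _ _).trans (le_of_eq ?_)
    simp only [abs_mul]
  refine h1.trans ?_
  rw [Finset.sum_sigma', l1, l1, Finset.sum_mul_sum, ← Finset.sum_product']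
  set g : (Σ _ : Word d, ℕ) → Word d × Word d := fun x => (x.1.take x.2, x.1.drop x.2) with hg
  have hinj : Set.InjOn g ((wordsLE d n).sigma fun w => Finset.range (w.length + 1)) := by
    rintro ⟨w, k⟩ hx ⟨w', k'⟩ hx' h
    simp only [hg, Prod.mk.injEq] at h
    simp only [Finset.coe_sigma, Set.mem_sigma_iff, Finset.mem_coe, Finset.mem_range] at hx hx'
    have hw : w = w' := by
      rw [← List.take_append_drop k w, h.1, h.2, List.take_append_drop]
    subst hw
    have := congrArg List.length h.1
    rw [List.length_take, List.length_take] at this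
    have hk : k = k' := by omega
    rw [hk]
  calc _ = ∑ p ∈ ((wordsLE d n).sigma fun w => Finset.range (w.length + 1)).image g,
        |coef p.1 P| * |coef p.2 Q| := (Finset.sum_image hinj).symm
    _ ≤ _ := by
      refine Finset.sum_le_sum_of_subset_of_nonneg ?_ fun _ _ _ => by positivity
      intro p hp
      obtain ⟨⟨w, k⟩, hx, rfl⟩ := Finset.mem_image.mp hp
      have hw := mem_wordsLE.mp (Finset.mem_sigma.mp hx).1
      have := weight_take_add_drop w k
      simp only [hg, Finset.mem_product, mem_wordsLE]
      simp only at hw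
      omega

theorem l1_pow_le (n : ℕ) (P : NC d) (k : ℕ) : l1 n (P ^ k) ≤ l1 n P ^ k := by
  induction k with
  | zero => simp [l1_one]
  | succ k ih =>
    rw [pow_succ, pow_succ]
    exact (l1_mul_le n _ _).trans (mul_le_mul_of_nonneg_right ih (l1_nonneg _ _))

theorem l1_tr_le (n m : ℕ) (P : NC d) : l1 n (tr m P) ≤ l1 n P := by
  refine Finset.sum_le_sum fun w _ => ?_
  rw [coef_tr]; split_ifs
  · exact le_rfl
  · simp

theorem rs_mem_poly {n : ℕ} {P : NC d} (hP : P ∈ poly d n) (t : ℝ) : rs t P ∈ poly d n :=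
  fun w hw => by rw [coef_rs, hP w hw, mul_zero]

/-- The source of all powers of `t`: in `rs t P` only powers `t ^ i` with `i ≥ j + 1` occur, and `t
≤ 1`. The fields of the finitely many words of weight at most `n` are bounded once and for all, so
`K` depends on neither `t` nor `P`. -/
theorem exists_cNorm_phiField_le (hV : ∀ i, IsCbSmooth (V i)) (n k : ℕ) :
    ∃ K : ℝ, 0 ≤ K ∧ ∀ (t : ℝ) (j : ℕ) (P : NC d), 0 ≤ t → t ≤ 1 → P ∈ poly d n →
      P ∈ fil d (j + 1) → IsCbSmooth (phiField V (rs t P)) ∧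
        cNorm k (phiField V (rs t P)) ≤ K * t ^ (j + 1) * l1 n P := by
  classical
  -- The value `0` at the empty word is a dummy that keeps the family in `C_b^∞`; positive order
  -- makes its coefficient vanish.
  set F : Word d → Euc N → Euc N := fun w => if w = [] then 0 else wordOp V w id with hF
  have hFs : ∀ w, IsCbSmooth (F w) := by
    intro w
    by_cases h : w = []
    · simp only [hF, h, if_true]; exact IsCbSmooth.zero
    · simp only [hF, h, if_false]; exact IsCbSmooth.wordOp_id hV h
  set K := ∑ w ∈ wordsLE d n, cNorm k (F w) with hK
  have hK0 : 0 ≤ K := Finset.sum_nonneg fun _ _ => cNorm_nonneg _ _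
  refine ⟨K, hK0, fun t j P ht0 ht1 hP hPf => ?_⟩
  have e : phiField V (rs t P) = fun x => ∑ w ∈ wordsLE d n, coef w (rs t P) • F w x := by
    refine (phiOp_eq_sum (rs_mem_poly hP t) id).trans ?_
    funext x
    refine Finset.sum_congr rfl fun w _ => ?_
    by_cases h : w = []
    · rw [coef_rs, hPf w (by rw [h, weight_nil]; omega)]; simp
    · simp only [hF, h, if_false]
  rw [e]
  refine ⟨IsCbSmooth.sum_smul _ _ fun w _ => hFs w, ?_⟩
  refine (cNorm_sum_smul_le _ _ (fun w _ => hFs w) k).trans ?_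
  rw [l1, Finset.mul_sum]
  refine Finset.sum_le_sum fun w hw => ?_
  have h1 : cNorm k (F w) ≤ K :=
    Finset.single_le_sum (f := fun w => cNorm k (F w)) (fun _ _ => cNorm_nonneg _ _) hw
  have h2 : |coef w (rs t P)| ≤ t ^ (j + 1) * |coef w P| := by
    rw [coef_rs, abs_mul, abs_of_nonneg (pow_nonneg ht0 _)]
    rcases lt_or_ge (weight w) (j + 1) with h | h
    · rw [hPf w h]; simp
    · exact mul_le_mul_of_nonneg_right (pow_le_pow_of_le_one ht0 ht1 h) (abs_nonneg _)
  calc _ ≤ (t ^ (j + 1) * |coef w P|) * K :=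
        mul_le_mul h2 h1 (cNorm_nonneg _ _) (by positivity)
    _ = _ := by ring

end phi

/-! ### Flows -/

section flow

open NC

variable {N d : ℕ}

theorem IsCbSmooth.exists_isSolution {W : Euc N → Euc N} (hW : IsCbSmooth W) (x : Euc N) :
    ∃ z, IsSolution W x z := by
  -- Radius and speed bound are the same number: at that speed the curve stays in the ball for unit
  -- time.
  have h : IsPicardLindelof (fun _ => W) (tmin := 0) (tmax := 1) ⟨0, by simp⟩ x
      (cNorm 1 W).toNNReal 0 (cNorm 1 W).toNNReal (cNorm 1 W).toNNReal := by
    refine IsPicardLindelof.of_time_independent (fun y _ => ?_)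
      (hW.lipschitzWith le_rfl).lipschitzOnWith ?_
    · rw [Real.coe_toNNReal _ (cNorm_nonneg _ _)]; exact hW.norm_le_cNorm 1 y
    · simp
  exact h.exists_eq_forall_mem_Icc_hasDerivWithinAt₀

/-- The estimates below hold along any solution, so no appeal to uniqueness is made. -/
theorem IsCbSmooth.flowExp_spec {W : Euc N → Euc N} (hW : IsCbSmooth W) (x : Euc N) :
    ∃ z, IsSolution W x z ∧ flowExp W x = z 1 := by
  have h := hW.exists_isSolution x
  exact ⟨h.choose, h.choose_spec, by rw [flowExp, dif_pos h]⟩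

/-- Grönwall's inequality, with the `C^n` norm as Lipschitz constant. -/
theorem IsCbSmooth.norm_flowExp_sub_le {W : Euc N → Euc N} (hW : IsCbSmooth W) {n : ℕ}
    (hn : 1 ≤ n) (x y : Euc N) :
    ‖flowExp W x - flowExp W y‖ ≤ Real.exp (cNorm n W) * ‖x - y‖ := by
  obtain ⟨z, ⟨hz0, hz⟩, hzx⟩ := hW.flowExp_spec x
  obtain ⟨u, ⟨hu0, hu⟩, huy⟩ := hW.flowExp_spec y
  have right : ∀ {v : ℝ → Euc N}, (∀ t ∈ Set.Icc (0 : ℝ) 1,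
      HasDerivWithinAt v (W (v t)) (Set.Icc 0 1) t) →
      ∀ t ∈ Set.Ico (0 : ℝ) 1, HasDerivWithinAt v (W (v t)) (Set.Ici t) t := by
    intro v hv t ht
    refine (hv t ⟨ht.1, ht.2.le⟩).mono_of_mem_nhdsWithin ?_
    exact Filter.mem_of_superset (Icc_mem_nhdsGE ht.2) (Set.Icc_subset_Icc_left ht.1)
  have h := dist_le_of_trajectories_ODE (v := fun _ => W) (δ := ‖x - y‖)
    (fun _ => hW.lipschitzWith hn) (fun t ht => (hz t ht).continuousWithinAt) (right hz)
    (fun t ht => (hu t ht).continuousWithinAt) (right hu) (by rw [hz0, hu0, dist_eq_norm])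
    1 (by simp)
  rw [hzx, huy, ← dist_eq_norm]
  rwa [Real.coe_toNNReal _ (cNorm_nonneg _ _), sub_zero, mul_one, mul_comm] at h

/-- Taylor expansion of a curve whose successive derivatives are given. -/
theorem norm_sub_taylor_le {E : Type*} [NormedAddCommGroup E] [NormedSpace ℝ E] {C : ℝ} (n : ℕ)
    (h : ℕ → ℝ → E)
    (hd : ∀ k < n, ∀ t ∈ Set.Icc (0 : ℝ) 1, HasDerivWithinAt (h k) (h (k + 1) t) (Set.Icc 0 1) t)
    (hC : ∀ t ∈ Set.Icc (0 : ℝ) 1, ‖h n t‖ ≤ C) :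
    ∀ t ∈ Set.Icc (0 : ℝ) 1,
      ‖h 0 t - ∑ k ∈ Finset.range n, (t ^ k * (k.factorial : ℝ)⁻¹) • h k 0‖ ≤ C := by
  induction n generalizing h with
  | zero => simpa using hC
  | succ n ih =>
    -- The derivative of the remainder is the remainder of the shifted family, and integration over
    -- a subinterval of `[0, 1]` keeps the bound `C`.
    have ih' := ih (fun k => h (k + 1)) (fun k hk => hd (k + 1) (by omega)) hC
    set f : ℝ → E := fun t =>
      h 0 t - ∑ k ∈ Finset.range (n + 1), (t ^ k * (k.factorial : ℝ)⁻¹) • h k 0 with hf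
    have hf' : ∀ t ∈ Set.Icc (0 : ℝ) 1, HasDerivWithinAt f
        (h 1 t - ∑ k ∈ Finset.range n, (t ^ k * (k.factorial : ℝ)⁻¹) • h (k + 1) 0)
        (Set.Icc 0 1) t := by
      intro t ht
      refine (hd 0 (by omega) t ht).sub ?_
      have e : ∑ k ∈ Finset.range n, (t ^ k * (k.factorial : ℝ)⁻¹) • h (k + 1) 0
          = ∑ k ∈ Finset.range (n + 1),
            ((k : ℝ) * t ^ (k - 1) * (k.factorial : ℝ)⁻¹) • h k 0 := by
        rw [Finset.sum_range_succ' _ n]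
        simp only [Nat.cast_zero, zero_mul, zero_smul, add_zero]
        refine Finset.sum_congr rfl fun k _ => ?_
        congr 1
        rw [Nat.factorial_succ, Nat.add_sub_cancel]
        have : ((k : ℝ) + 1) ≠ 0 := by positivity
        push_cast
        field_simp
      rw [e]
      refine HasDerivWithinAt.fun_sum fun k _ => ?_
      exact (((hasDerivAt_pow k t).hasDerivWithinAt).mul_const _).smul_const _
    intro t ht
    have h1 := norm_image_sub_le_of_norm_deriv_le_segment' hf'
      (fun s hs => ih' s ⟨hs.1, hs.2.le⟩) t ht
    have h0 : f 0 = 0 := by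
      simp only [hf]
      rw [Finset.sum_range_succ', Finset.sum_eq_zero]
      · simp
      · intro k _; simp
    have hC0 : 0 ≤ C := (norm_nonneg _).trans (hC 0 (by simp))
    rw [h0, sub_zero, sub_zero] at h1
    exact h1.trans (mul_le_of_le_one_right hC0 ht.2)

variable {V : Fin (d + 1) → Euc N → Euc N}

/-- Expansion of a polynomial vector field along the flow of a Lie polynomial. -/
theorem norm_phiField_flowExp_sub_le (hV : ∀ i, Smooth (V i)) {L Q : NC d} (hL : L ∈ liePoly d)
    (hLs : IsCbSmooth (phiField V L)) {i j : ℕ} (hLp : L ∈ poly d i) (hQ : Q ∈ poly d j) (n : ℕ)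
    {C : ℝ} (hC : ∀ y, ‖phiField V (L ^ n * Q) y‖ ≤ C) (x : Euc N) :
    ‖phiField V Q (flowExp (phiField V L) x)
      - phiField V (∑ k ∈ Finset.range n, (k.factorial : ℝ)⁻¹ • (L ^ k * Q) : NC d) x‖ ≤ C := by
  have hid : Smooth (id : Euc N → Euc N) := contDiff_id
  have hmem : ∀ k, L ^ k * Q ∈ poly d (k * i + j) := fun k => mul_mem_poly (pow_mem_poly hLp k) hQ
  obtain ⟨z, ⟨hz0, hz⟩, hzx⟩ := hLs.flowExp_spec x
  have key := norm_sub_taylor_le n (fun k t => phiField V (L ^ k * Q) (z t)) (C := C) ?_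
    (fun t _ => hC _) 1 (by simp)
  · rw [hzx]
    have e : phiField V (∑ k ∈ Finset.range n, (k.factorial : ℝ)⁻¹ • (L ^ k * Q) : NC d) x
        = ∑ k ∈ Finset.range n,
          ((1 : ℝ) ^ k * (k.factorial : ℝ)⁻¹) • phiField V (L ^ k * Q) (z 0) := by
      have h := phiOp_sum (V := V) (n := n * i + j) (Finset.range n)
        (P := fun k => (k.factorial : ℝ)⁻¹ • (L ^ k * Q))
        (fun k hk => Submodule.smul_mem _ _ (poly_mono (by
          have := Finset.mem_range.mp hk
          gcongr) (hmem k))) id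
      refine (congrFun h x).trans ?_
      rw [Finset.sum_apply]
      refine Finset.sum_congr rfl fun k _ => ?_
      rw [phiOp_smul (hmem k), hz0, one_pow, one_mul]; rfl
    rw [e]
    simpa using key
  · intro k _ t ht
    have h1 : Smooth (phiField V (L ^ k * Q)) := Smooth.phiOp hV (hmem k) hid
    have h2 : HasFDerivAt (phiField V (L ^ k * Q)) (fderiv ℝ (phiField V (L ^ k * Q)) (z t)) (z t) :=
      (h1.differentiable (by simp) _).hasFDerivAt
    have h3 := h2.comp_hasDerivWithinAt t (hz t ht)
    have e1 : L ^ (k + 1) * Q = L * (L ^ k * Q) := by rw [pow_succ', mul_assoc]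
    -- The Lie property of `L` is essential here: it makes `Φ(L)` the derivative along the field
    -- that drives `z`.
    have e2 : phiField V (L * (L ^ k * Q)) = derivAlong (phiField V L) (phiField V (L ^ k * Q)) := by
      refine (phiOp_mul hV hLp (hmem k) hid).trans ?_
      exact (liePoly_phiOp hV hL).2 _ h1
    have e3 : phiField V (L ^ (k + 1) * Q) (z t)
        = fderiv ℝ (phiField V (L ^ k * Q)) (z t) (phiField V L (z t)) := by rw [e1, e2]; rfl
    change HasDerivWithinAt _ (phiField V (L ^ (k + 1) * Q) (z t)) _ _
    rw [e3]; exact h3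

end flow

/-! ### Functions of at most exponential growth -/

/-- Non-negative functions on `[0, ∞)` bounded by `C exp (c R)`. -/
def ExpBdd (f : ℝ → ℝ) : Prop :=
  ∃ C c : ℝ, 0 ≤ C ∧ 0 ≤ c ∧ ∀ R, 0 ≤ R → 0 ≤ f R ∧ f R ≤ C * Real.exp (c * R)

theorem ExpBdd.const {a : ℝ} (ha : 0 ≤ a) : ExpBdd fun _ => a :=
  ⟨a, 0, ha, le_rfl, fun R _ => ⟨ha, by simp⟩⟩

theorem ExpBdd.id : ExpBdd fun R => R :=
  ⟨1, 1, zero_le_one, zero_le_one, fun R hR => ⟨hR, by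
    have := Real.add_one_le_exp R; simp only [one_mul]; linarith⟩⟩

theorem ExpBdd.exp {a : ℝ} (ha : 0 ≤ a) : ExpBdd fun R => Real.exp (a * R) :=
  ⟨1, a, zero_le_one, ha, fun R _ => ⟨(Real.exp_pos _).le, by simp⟩⟩

theorem ExpBdd.add {f g : ℝ → ℝ} (hf : ExpBdd f) (hg : ExpBdd g) : ExpBdd fun R => f R + g R := by
  obtain ⟨C, c, hC, hc, hf⟩ := hf
  obtain ⟨D, e, hD, he, hg⟩ := hg
  refine ⟨C + D, max c e, add_nonneg hC hD, hc.trans (le_max_left _ _), fun R hR =>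
    ⟨add_nonneg (hf R hR).1 (hg R hR).1, ?_⟩⟩
  have h1 : C * Real.exp (c * R) ≤ C * Real.exp (max c e * R) := by gcongr; exact le_max_left _ _
  have h2 : D * Real.exp (e * R) ≤ D * Real.exp (max c e * R) := by gcongr; exact le_max_right _ _
  rw [add_mul]
  exact add_le_add ((hf R hR).2.trans h1) ((hg R hR).2.trans h2)

theorem ExpBdd.mul {f g : ℝ → ℝ} (hf : ExpBdd f) (hg : ExpBdd g) : ExpBdd fun R => f R * g R := by
  obtain ⟨C, c, hC, hc, hf⟩ := hf
  obtain ⟨D, e, hD, he, hg⟩ := hg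
  refine ⟨C * D, c + e, mul_nonneg hC hD, add_nonneg hc he, fun R hR =>
    ⟨mul_nonneg (hf R hR).1 (hg R hR).1, ?_⟩⟩
  refine (mul_le_mul (hf R hR).2 (hg R hR).2 (hg R hR).1 (by positivity)).trans (le_of_eq ?_)
  rw [add_mul, Real.exp_add]; ring

theorem ExpBdd.pow {f : ℝ → ℝ} (hf : ExpBdd f) (k : ℕ) : ExpBdd fun R => f R ^ k := by
  induction k with
  | zero => simpa using ExpBdd.const zero_le_one
  | succ k ih => simpa only [pow_succ] using ih.mul hf

theorem ExpBdd.comp_mul {f : ℝ → ℝ} (hf : ExpBdd f) {a : ℝ} (ha : 0 ≤ a) :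
    ExpBdd fun R => f (a * R) := by
  obtain ⟨C, c, hC, hc, hf⟩ := hf
  refine ⟨C, c * a, hC, mul_nonneg hc ha, fun R hR => ?_⟩
  have := hf (a * R) (mul_nonneg ha hR)
  rwa [mul_assoc]

/-! ### Compositions of approximately equal maps -/

/-- The composition of a list of maps, the head being applied last. -/
def listComp {α : Type*} (l : List (α → α)) : α → α := l.foldr (fun h k => h ∘ k) id

theorem listComp_append_singleton {α : Type*} (l : List (α → α)) (f : α → α) :
    listComp (l ++ [f]) = listComp l ∘ f := by
  induction l with
  | nil => rfl
  | cons a l ih =>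
    change a ∘ listComp (l ++ [f]) = _
    rw [ih]; rfl

/-- Each further map adds an error `ε` and stretches the earlier one by `Λ`. Only the maps `g` need
be Lipschitz, which matters since integration schemes are arbitrary maps. -/
theorem norm_listComp_sub_le {E ι : Type*} [NormedAddCommGroup E] {f g : ι → E → E} {ε Λ : ℝ}
    (hε : 0 ≤ ε) (hΛ : 1 ≤ Λ) (hfg : ∀ i x, ‖f i x - g i x‖ ≤ ε)
    (hg : ∀ i x y, ‖g i x - g i y‖ ≤ Λ * ‖x - y‖) (l : List ι) (x : E) :
    ‖listComp (l.map f) x - listComp (l.map g) x‖ ≤ l.length * ε * Λ ^ l.length := by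
  induction l with
  | nil => simp [listComp]
  | cons i l ih =>
    have h1 := hfg i (listComp (l.map f) x)
    have h2 := hg i (listComp (l.map f) x) (listComp (l.map g) x)
    have h3 : ε ≤ ε * Λ ^ (l.length + 1) := le_mul_of_one_le_right hε (one_le_pow₀ hΛ)
    have h4 : Λ * ‖listComp (l.map f) x - listComp (l.map g) x‖
        ≤ Λ * (l.length * ε * Λ ^ l.length) := by gcongr
    calc _ ≤ ‖f i (listComp (l.map f) x) - g i (listComp (l.map f) x)‖
          + ‖g i (listComp (l.map f) x) - g i (listComp (l.map g) x)‖ :=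
            norm_sub_le_norm_sub_add_norm_sub _ _ _
      _ ≤ ε * Λ ^ (l.length + 1) + Λ * (l.length * ε * Λ ^ l.length) := by linarith
      _ = _ := by rw [List.length_cons]; push_cast; ring

/-! ### The deterministic estimate -/

section estimate

open NC

variable {N d : ℕ} {V : Fin (d + 1) → Euc N → Euc N}

/-- Partial sums of `exp(L) Q`. -/
def expSum (m : ℕ) (L Q : NC d) : NC d :=
  ∑ k ∈ Finset.range (m + 1), (k.factorial : ℝ)⁻¹ • (L ^ k * Q)

theorem tr_ex_mul {m : ℕ} {L : NC d} (hL : L ∈ fil d 1) (Q : NC d) :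
    tr m (ex L * Q) = tr m (expSum m L Q) := by
  rw [tr_eq_tr_iff]
  have := mul_mem_fil_right (ex_sub_mem_fil hL (m + 1)) Q
  simpa [sub_mul, Finset.sum_mul, expSum] using this

theorem l1_expSum_le (n m : ℕ) (L Q : NC d) :
    l1 n (expSum m L Q) ≤ (m + 1) * (1 + l1 n L) ^ (m + 1) * l1 n Q := by
  have hL := l1_nonneg n L
  have hQ := l1_nonneg n Q
  refine (l1_sum_le n _ _).trans ?_
  have h : ∀ k ∈ Finset.range (m + 1), l1 n ((k.factorial : ℝ)⁻¹ • (L ^ k * Q))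
      ≤ (1 + l1 n L) ^ (m + 1) * l1 n Q := by
    intro k hk
    rw [l1_smul, abs_of_nonneg (by positivity)]
    have h1 : (k.factorial : ℝ)⁻¹ ≤ 1 :=
      inv_le_one_of_one_le₀ (mod_cast Nat.succ_le_of_lt k.factorial_pos)
    have h2 : l1 n (L ^ k * Q) ≤ (1 + l1 n L) ^ (m + 1) * l1 n Q := by
      refine (l1_mul_le n _ _).trans (mul_le_mul_of_nonneg_right ?_ hQ)
      calc _ ≤ l1 n L ^ k := l1_pow_le n L k
        _ ≤ (1 + l1 n L) ^ k := by gcongr; linarith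
        _ ≤ _ := pow_le_pow_right₀ (by linarith) (Finset.mem_range.mp hk).le
    exact (mul_le_of_le_one_left (l1_nonneg _ _) h1).trans h2
  refine (Finset.sum_le_sum h).trans (le_of_eq ?_)
  simp [mul_assoc]

theorem expSum_mem_poly {m : ℕ} {L Q : NC d} (hL : L ∈ poly d m) (hQ : Q ∈ poly d m) :
    expSum m L Q ∈ poly d ((m + 1) * m + m) :=
  Submodule.sum_mem _ fun k hk => Submodule.smul_mem _ _ (poly_mono
    (by have := Finset.mem_range.mp hk; gcongr) (mul_mem_poly (pow_mem_poly hL k) hQ))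

/-- Local error of one exponential, with a constant independent of the polynomials. -/
theorem exists_flow_step (hV : ∀ i, IsCbSmooth (V i)) (m : ℕ) :
    ∃ K : ℝ, 0 ≤ K ∧ ∀ (t : ℝ) (L Q : NC d), 0 ≤ t → t ≤ 1 → L ∈ lieSer d → L ∈ poly d m →
      Q ∈ poly d m → ∀ x : Euc N,
        ‖phiField V (rs t Q) (flowExp (phiField V (rs t L)) x)
            - phiField V (rs t (tr m (ex L * Q))) x‖
          ≤ K * t ^ (m + 1)
            * ((1 + l1 ((m + 1) * m + m) L) ^ (m + 1) * l1 ((m + 1) * m + m) Q) := by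
  -- The largest weight occurring in `L ^ (m + 1) * Q`, the Taylor remainder.
  set n := (m + 1) * m + m with hn
  obtain ⟨K, hK, hKP⟩ := exists_cNorm_phiField_le hV n 0
  have hVs : ∀ i, Smooth (V i) := fun i => (hV i).1
  have hbound : ∀ (t : ℝ) (j : ℕ) (P : NC d), 0 ≤ t → t ≤ 1 → P ∈ poly d n → P ∈ fil d (j + 1) →
      ∀ x, ‖phiField V (rs t P) x‖ ≤ K * t ^ (j + 1) * l1 n P := fun t j P h0 h1 hP hj x =>
    ((hKP t j P h0 h1 hP hj).1.norm_le_cNorm 0 x).trans (hKP t j P h0 h1 hP hj).2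
  -- The first summand pays for the Taylor remainder, the second for the terms of weight above `m`
  -- dropped from the partial sum.
  refine ⟨K + 2 * K * (m + 1), by positivity, fun t L Q ht0 ht1 hLie hLp hQ x => ?_⟩
  have hLf := lieSer_le_fil hLie
  have hLn : L ∈ poly d n := poly_mono (by rw [hn]; omega) hLp
  have hl := l1_nonneg n L
  have hq := l1_nonneg n Q
  set B := (1 + l1 n L) ^ (m + 1) * l1 n Q with hB
  have hT := expSum_mem_poly hLp hQ
  have hTn : tr m (expSum m L Q) ∈ poly d n := poly_mono (by rw [hn]; omega) (tr_mem_poly m _)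
  have hpow : L ^ (m + 1) * Q ∈ poly d n := mul_mem_poly (pow_mem_poly hLp _) hQ
  have hpowf : L ^ (m + 1) * Q ∈ fil d (m + 1) := mul_mem_fil_right (pow_mem_fil hLf _) Q
  have e1 : rs t (L ^ (m + 1) * Q) = rs t L ^ (m + 1) * rs t Q := by simp
  have e2 : rs t (expSum m L Q)
      = ∑ k ∈ Finset.range (m + 1), (k.factorial : ℝ)⁻¹ • (rs t L ^ k * rs t Q) := by
    simp [expSum, map_sum]
  have hpowl : l1 n (L ^ (m + 1) * Q) ≤ B := by
    refine (l1_mul_le n _ _).trans (mul_le_mul_of_nonneg_right ?_ hq)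
    refine (l1_pow_le n L _).trans ?_
    gcongr; linarith
  have h1 : ‖phiField V (rs t Q) (flowExp (phiField V (rs t L)) x)
      - phiField V (rs t (expSum m L Q)) x‖ ≤ K * t ^ (m + 1) * B := by
    rw [e2]
    refine norm_phiField_flowExp_sub_le hVs
      (mem_liePoly_of_mem_lieSer (rs_mem_lieSer hLie t) (rs_mem_poly hLp t))
      (hKP t 0 L ht0 ht1 hLn hLf).1 (rs_mem_poly hLp t) (rs_mem_poly hQ t) (m + 1) (fun y => ?_) x
    rw [← e1]
    refine (hbound t m _ ht0 ht1 hpow hpowf y).trans ?_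
    gcongr
  have h2 : ‖phiField V (rs t (expSum m L Q)) x - phiField V (rs t (tr m (ex L * Q))) x‖
      ≤ 2 * K * (m + 1) * t ^ (m + 1) * B := by
    have e3 := phiOp_sub (V := V) (rs_mem_poly hT t) (rs_mem_poly hTn t) id
    rw [← map_sub] at e3
    have e4 := congrFun e3 x
    rw [tr_ex_mul hLf]
    change ‖(phiOp V (rs t (expSum m L Q)) id - phiOp V (rs t (tr m (expSum m L Q))) id) x‖ ≤ _
    rw [← e4]
    refine (hbound t m _ ht0 ht1 (Submodule.sub_mem _ hT hTn) (sub_tr_mem_fil m _) x).trans ?_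
    have h3 : l1 n (expSum m L Q - tr m (expSum m L Q)) ≤ 2 * ((m + 1) * B) := by
      have h4 := l1_expSum_le n m L Q
      rw [mul_assoc, ← hB] at h4
      have h5 := l1_sub_le n (expSum m L Q) (tr m (expSum m L Q))
      have h6 := l1_tr_le n m (expSum m L Q)
      linarith
    calc _ ≤ K * t ^ (m + 1) * (2 * ((m + 1) * B)) := by gcongr
      _ = _ := by ring
  calc _ ≤ _ := norm_sub_le_norm_sub_add_norm_sub _ (phiField V (rs t (expSum m L Q)) x) _
    _ ≤ K * t ^ (m + 1) * B + 2 * K * (m + 1) * t ^ (m + 1) * B := add_le_add h1 h2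
    _ = _ := by ring

theorem phiField_one : phiField V (1 : NC d) = id := phiOp_one id

theorem tr_one (m : ℕ) : tr m (1 : NC d) = 1 := tr_eq_self (one_mem_poly m)

/-- The composition of flows, expanded up to weight `m`. -/
theorem exists_flow_comp (hV : ∀ i, IsCbSmooth (V i)) (m : ℕ) :
    ∃ K : ℝ, 0 ≤ K ∧ ∀ (t R : ℝ), 0 ≤ t → t ≤ 1 → 0 ≤ R → ∀ r : List (NC d),
      (∀ z ∈ r, z ∈ lieSer d ∧ z ∈ poly d m ∧ l1 ((m + 1) * m + m) z ≤ R) →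
        l1 ((m + 1) * m + m) (tr m (expProd r)) ≤ ((m + 1) * (1 + R) ^ (m + 1)) ^ r.length ∧
        ∀ x : Euc N,
          ‖listComp (r.reverse.map fun z => flowExp (phiField V (rs t z))) x
              - phiField V (rs t (tr m (expProd r))) x‖
            ≤ r.length * K * t ^ (m + 1) * ((m + 1) * (1 + R) ^ (m + 1)) ^ r.length := by
  set n := (m + 1) * m + m with hn
  obtain ⟨K, hK, hstep⟩ := exists_flow_step hV m
  refine ⟨K, hK, fun t R ht0 ht1 hR r => ?_⟩
  -- The factor by which one exponential can enlarge the `ℓ¹` norm, by `l1_expSum_le`.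
  set G := ((m : ℝ) + 1) * (1 + R) ^ (m + 1) with hG
  have hG1 : 1 ≤ G := by
    have : (1 : ℝ) ≤ (1 + R) ^ (m + 1) := one_le_pow₀ (by linarith)
    rw [hG]; nlinarith [Nat.cast_nonneg (α := ℝ) m]
  induction r with
  | nil =>
    intro _
    have e : expProd ([] : List (NC d)) = 1 := rfl
    rw [e, tr_one]
    refine ⟨by simp [l1_one], fun x => ?_⟩
    rw [map_one, phiField_one]
    simp [listComp]
  | cons z r ih =>
    intro hr
    obtain ⟨hzL, hzp, hzR⟩ := hr z (by simp)
    obtain ⟨ih1, ih2⟩ := ih fun z hz => hr z (by simp [hz])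
    have hzf := lieSer_le_fil hzL
    have e : tr m (expProd (z :: r)) = tr m (ex z * tr m (expProd r)) := by
      rw [tr_eq_tr_iff]
      have : expProd (z :: r) = ex z * expProd r := by simp [expProd]
      rw [this, ← mul_sub]
      exact mul_mem_fil_left _ (sub_tr_mem_fil m _)
    set Q := tr m (expProd r) with hQ
    have hl : (1 + l1 n z) ^ (m + 1) ≤ (1 + R) ^ (m + 1) := by
      have := l1_nonneg n z; gcongr
    have hq := l1_nonneg n Q
    constructor
    · rw [e, tr_ex_mul hzf, List.length_cons, pow_succ']
      refine (l1_tr_le _ _ _).trans ((l1_expSum_le n m z Q).trans ?_)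
      rw [hG]
      gcongr
    · intro x
      -- The leftmost exponential belongs to the innermost flow, since precomposing with a flow
      -- multiplies the series on the left. The induction hypothesis is uniform in the point and is
      -- used at the image under this flow.
      rw [List.reverse_cons, List.map_append, List.map_singleton, listComp_append_singleton, e]
      have h1 := ih2 (flowExp (phiField V (rs t z)) x)
      have h2 := hstep t z Q ht0 ht1 hzL hzp (tr_mem_poly m _) x
      have h3 : (1 + l1 n z) ^ (m + 1) * l1 n Q ≤ G ^ (r.length + 1) := by
        rw [pow_succ' G]
        refine mul_le_mul (hl.trans ?_) ih1 hq (by positivity)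
        rw [hG]
        have : (0 : ℝ) ≤ (1 + R) ^ (m + 1) := by positivity
        nlinarith [Nat.cast_nonneg (α := ℝ) m]
      have h4 : K * t ^ (m + 1) * ((1 + l1 n z) ^ (m + 1) * l1 n Q)
          ≤ K * t ^ (m + 1) * G ^ (r.length + 1) := by gcongr
      have h5 : r.length * K * t ^ (m + 1) * G ^ r.length
          ≤ r.length * K * t ^ (m + 1) * G ^ (r.length + 1) := by
        gcongr
        omega
      calc _ ≤ _ := norm_sub_le_norm_sub_add_norm_sub _
            (phiField V (rs t Q) (flowExp (phiField V (rs t z)) x)) _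
        _ ≤ r.length * K * t ^ (m + 1) * G ^ (r.length + 1) + K * t ^ (m + 1) * G ^ (r.length + 1) :=
          add_le_add (h1.trans h5) (h2.trans h4)
        _ = _ := by rw [List.length_cons]; push_cast; ring

/-- Up to weight `m` the logarithm depends only on the truncation of `Q`, through `m` powers with
coefficients of modulus at most one. -/
theorem l1_tr_lg_le {n m : ℕ} {Q : NC d} (hQ : Q - 1 ∈ fil d 1) {G : ℝ}
    (hG : l1 n (tr m Q) ≤ G) : l1 n (tr m (lg Q)) ≤ m * (1 + G) ^ m := by
  have hG0 : 0 ≤ G := (l1_nonneg _ _).trans hG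
  set U := tr m Q - 1 with hU
  have hU1 : l1 n U ≤ 1 + G := by
    have := l1_sub_le n (tr m Q) 1
    rw [l1_one] at this; linarith
  have hUQ : (Q - 1) - U ∈ fil d (m + 1) := by
    have := sub_tr_mem_fil m Q
    rw [hU]; simpa using this
  have e : tr m (lg Q) = tr m (∑ k ∈ Finset.range m, ((-1 : ℝ) ^ k / (k + 1)) • U ^ (k + 1)) := by
    rw [tr_eq_tr_iff]
    refine sub_mem_fil_trans (lg_sub_mem_fil hQ m) ?_
    rw [← Finset.sum_sub_distrib]
    refine Submodule.sum_mem _ fun k _ => ?_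
    rw [← smul_sub]
    exact Submodule.smul_mem _ _ (pow_sub_pow_mem_fil hUQ _)
  rw [e]
  refine (l1_tr_le _ _ _).trans ((l1_sum_le _ _ _).trans ?_)
  have h : ∀ k ∈ Finset.range m, l1 n (((-1 : ℝ) ^ k / (k + 1)) • U ^ (k + 1)) ≤ (1 + G) ^ m := by
    intro k hk
    rw [l1_smul]
    have h1 : |(-1 : ℝ) ^ k / (k + 1)| ≤ 1 := by
      rw [abs_div, abs_pow, abs_neg, abs_one, one_pow, abs_of_pos (by positivity)]
      rw [div_le_one (by positivity)]
      linarith [Nat.cast_nonneg (α := ℝ) k]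
    refine (mul_le_of_le_one_left (l1_nonneg _ _) h1).trans ?_
    calc _ ≤ l1 n U ^ (k + 1) := l1_pow_le n U _
      _ ≤ (1 + G) ^ (k + 1) := by
        have := l1_nonneg n U; gcongr
      _ ≤ _ := pow_le_pow_right₀ (by linarith) (Finset.mem_range.mp hk)
  refine (Finset.sum_le_sum h).trans (le_of_eq ?_)
  simp

theorem l1_le_card_mul {n : ℕ} {P : NC d} {R : ℝ} (h : ∀ w, |coef w P| ≤ R) :
    l1 n P ≤ (wordsLE d n).card * R := by
  refine (Finset.sum_le_sum fun w _ => h w).trans (le_of_eq ?_)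
  simp

/-- The error of the composed schemes for Lie polynomials with bounded coefficients. -/
theorem exists_scheme_error_le (hV : ∀ i, IsCbSmooth (V i)) (m M : ℕ)
    {g : Fin M → (Euc N → Euc N) → Euc N → Euc N} (hg : ∀ i, IsIntegrationScheme m (g i)) :
    ∃ C c : ℝ, 0 ≤ C ∧ 0 ≤ c ∧ ∀ (t R : ℝ) (z : Fin M → NC d), 0 ≤ t → t ≤ 1 → 0 ≤ R →
      (∀ i, z i ∈ lieSer d ∧ z i ∈ poly d m ∧ ∀ w, |coef w (z i)| ≤ R) → ∀ x : Euc N,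
        ‖compAll (fun i => g i (phiField V (rs t (z i)))) x
            - flowExp (phiField V (rs t (tr m (lg (expProd (List.ofFn z).reverse))))) x‖
          ≤ C * t ^ (m + 1) * Real.exp (c * R) := by
  set n := (m + 1) * m + m with hn
  obtain ⟨K₁, hK₁, hcN⟩ := exists_cNorm_phiField_le hV n (m + 1)
  obtain ⟨K₂, hK₂, hstep⟩ := exists_flow_step hV m
  obtain ⟨K₃, hK₃, hcomp⟩ := exists_flow_comp hV m
  choose Cg hCg0 hCg using hg
  set Cs := ∑ i, Cg i with hCs
  have hCs0 : 0 ≤ Cs := Finset.sum_nonneg fun i _ => (hCg0 i).le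
  set G : ℝ → ℝ := fun R => ((m : ℝ) + 1) * (1 + R) ^ (m + 1) with hG
  -- The three summands bound, without their factor `t ^ (m + 1)`, the distances from schemes to
  -- flows, from flows to the common expansion, and from the target flow to that expansion.
  set D : ℝ → ℝ := fun R => M * (Cs * (K₁ * R) ^ (m + 1)) * Real.exp (K₁ * R) ^ M
    + M * K₃ * G R ^ M + K₂ * (1 + m * (1 + G R ^ M) ^ m) ^ (m + 1) with hD
  have hDexp : ExpBdd D := by
    have hm1 : (0 : ℝ) ≤ (m : ℝ) + 1 := by positivity
    have hGexp : ExpBdd G :=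
      (ExpBdd.const hm1).mul (((ExpBdd.const zero_le_one).add ExpBdd.id).pow _)
    refine ExpBdd.add (ExpBdd.add (ExpBdd.mul (ExpBdd.mul (.const M.cast_nonneg) (ExpBdd.mul
      (.const hCs0) (ExpBdd.pow (ExpBdd.mul (.const hK₁) .id) _))) ((ExpBdd.exp hK₁).pow M))
      (ExpBdd.mul (.const (by positivity)) (hGexp.pow M)))
      (ExpBdd.mul (.const hK₂) (ExpBdd.pow (ExpBdd.add (.const zero_le_one)
        (ExpBdd.mul (.const m.cast_nonneg) (ExpBdd.pow (ExpBdd.add (.const zero_le_one)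
          (hGexp.pow M)) m))) _))
  -- The cardinality converts the bound on single coefficients into an `ℓ¹` bound.
  obtain ⟨C, c, hC, hc, hDb⟩ := hDexp.comp_mul (Nat.cast_nonneg (wordsLE d n).card)
  refine ⟨C, c, hC, hc, fun t R₀ z ht0 ht1 hR₀ hz x => ?_⟩
  set R := ((wordsLE d n).card : ℝ) * R₀ with hRdef
  have hR : 0 ≤ R := by positivity
  have hzl : ∀ i, l1 n (z i) ≤ R := fun i => l1_le_card_mul (hz i).2.2
  suffices h : ‖compAll (fun i => g i (phiField V (rs t (z i)))) x
      - flowExp (phiField V (rs t (tr m (lg (expProd (List.ofFn z).reverse))))) x‖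
        ≤ t ^ (m + 1) * D R by
    refine h.trans ?_
    have := mul_le_mul_of_nonneg_left (hDb R₀ hR₀).2 (pow_nonneg ht0 (m + 1))
    calc _ ≤ _ := this
      _ = _ := by ring
  have hzn : ∀ i, z i ∈ poly d n := fun i => poly_mono (by rw [hn]; omega) (hz i).2.1
  have hW : ∀ i, IsCbSmooth (phiField V (rs t (z i))) ∧
      cNorm (m + 1) (phiField V (rs t (z i))) ≤ K₁ * t * R := by
    intro i
    have h := hcN t 0 (z i) ht0 ht1 (hzn i) (lieSer_le_fil (hz i).1)
    refine ⟨h.1, h.2.trans ?_⟩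
    rw [zero_add, pow_one]
    have := hzl i
    gcongr
  -- the schemes compared with the flows
  have hA : ‖compAll (fun i => g i (phiField V (rs t (z i)))) x
      - listComp ((List.ofFn z).map fun z => flowExp (phiField V (rs t z))) x‖
        ≤ M * (Cs * (K₁ * t * R) ^ (m + 1)) * Real.exp (K₁ * R) ^ M := by
    have h := norm_listComp_sub_le (f := fun i => g i (phiField V (rs t (z i))))
      (g := fun i => flowExp (phiField V (rs t (z i)))) (ε := Cs * (K₁ * t * R) ^ (m + 1))
      (Λ := Real.exp (K₁ * R)) (by positivity) (Real.one_le_exp (by positivity))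
      (fun i x => ?_) (fun i x y => ?_) (List.finRange M) x
    · have e1 : (List.finRange M).map (fun i => g i (phiField V (rs t (z i))))
          = List.ofFn (fun i => g i (phiField V (rs t (z i)))) := (List.ofFn_eq_map).symm
      have e2 : (List.finRange M).map (fun i => flowExp (phiField V (rs t (z i))))
          = (List.ofFn z).map fun z => flowExp (phiField V (rs t z)) := by
        rw [List.ofFn_eq_map, List.map_map]; rfl
      rw [e1, e2, List.length_finRange] at h
      exact h
    · refine (hCg i _ (hW i).1 x).trans ?_
      have h1 : Cg i ≤ Cs :=
        Finset.single_le_sum (f := Cg) (fun i _ => (hCg0 i).le) (Finset.mem_univ i)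
      have h2 := cNorm_nonneg (m + 1) (phiField V (rs t (z i)))
      have h3 := (hW i).2
      gcongr
    · refine ((hW i).1.norm_flowExp_sub_le (n := m + 1) (by omega) x y).trans ?_
      have h3 : K₁ * t * R ≤ K₁ * R := by
        have : K₁ * R * t ≤ K₁ * R := mul_le_of_le_one_right (by positivity) ht1
        linarith
      have h4 := (hW i).2.trans h3
      gcongr
  -- the composition of flows compared with its expansion
  set r := (List.ofFn z).reverse with hr
  have hrz : ∀ y ∈ r, ∃ i, z i = y := by
    intro y hy
    rw [hr, List.mem_reverse, List.mem_ofFn] at hy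
    exact hy
  have hrlen : r.length = M := by simp [hr]
  obtain ⟨hB1, hB2⟩ := hcomp t R ht0 ht1 hR r (by
    intro y hy
    obtain ⟨i, rfl⟩ := hrz y hy
    exact ⟨(hz i).1, (hz i).2.1, hzl i⟩)
  have hrL : ∀ y ∈ r, y ∈ lieSer d := by
    intro y hy
    obtain ⟨i, rfl⟩ := hrz y hy
    exact (hz i).1
  have hB := hB2 x
  rw [hr, List.reverse_reverse, ← hr, hrlen] at hB
  rw [hrlen] at hB1
  -- the flow of the truncated Baker-Campbell-Hausdorff product compared with its expansion
  have hQ1 := expProd_sub_one_mem_fil fun y hy => lieSer_le_fil (hrL y hy)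
  set L := tr m (lg (expProd r)) with hL
  have hLl : l1 n L ≤ m * (1 + G R ^ M) ^ m := l1_tr_lg_le hQ1 hB1
  have hLlie : L ∈ lieSer d := tr_mem_lieSer (lg_expProd_mem_lieSer hrL) m
  have hE := hstep t L 1 ht0 ht1 hLlie (tr_mem_poly m _) (one_mem_poly m) x
  -- Both flows share one expansion: truncating the logarithm changes its exponential only above
  -- weight `m`.
  have hLex : tr m (ex L * 1) = tr m (expProd r) := by
    rw [mul_one, tr_eq_tr_iff]
    have := ex_sub_ex_mem_fil (lieSer_le_fil hLlie) (lg_mem_fil hQ1)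
      (sub_mem_fil_symm (sub_tr_mem_fil m (lg (expProd r))))
    rwa [ex_lg hQ1] at this
  rw [hLex, map_one, phiField_one, l1_one, mul_one] at hE
  have hE' : ‖flowExp (phiField V (rs t L)) x - phiField V (rs t (tr m (expProd r))) x‖
      ≤ K₂ * t ^ (m + 1) * (1 + m * (1 + G R ^ M) ^ m) ^ (m + 1) := by
    refine hE.trans ?_
    have := l1_nonneg n L
    gcongr
  have tri : ∀ a b c e : Euc N, ‖a - e‖ ≤ ‖a - b‖ + ‖b - c‖ + ‖e - c‖ := by
    intro a b c e
    have h1 := norm_sub_le_norm_sub_add_norm_sub a b e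
    have h2 := norm_sub_le_norm_sub_add_norm_sub b c e
    rw [norm_sub_rev c e] at h2
    linarith
  refine (tri _ _ _ _).trans ((add_le_add (add_le_add hA hB) hE').trans (le_of_eq ?_))
  simp only [hD, hG]
  ring

end estimate

/-! ### Reduction to finitely many linear functionals -/

/-- Finitely many members of a family of linear forms on a finite-dimensional space determine all of
them, through a linear map. -/
theorem exists_finset_linear_reconstruction {E ι : Type*} [AddCommGroup E] [Module ℝ E]
    [FiniteDimensional ℝ E] (ℓ : ι → E →ₗ[ℝ] ℝ) :
    ∃ (A : Finset ι) (r : (A → ℝ) →ₗ[ℝ] E), ∀ j z, ℓ j (r fun α => ℓ α z) = ℓ j z := by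
  classical
  have hfg : (Submodule.span ℝ (Set.range ℓ)).FG := IsNoetherian.noetherian _
  obtain ⟨s', hs', hspan⟩ := Submodule.fg_span_iff_fg_span_finset_subset _ |>.mp hfg
  rw [← Set.image_univ] at hs'
  obtain ⟨A, -, hA⟩ := Finset.subset_set_image_iff.mp hs'
  set T : E →ₗ[ℝ] (A → ℝ) := LinearMap.pi fun α : A => ℓ α with hT
  -- `T` need not be injective or surjective: a section over its range, extended arbitrarily,
  -- recovers a vector up to the common kernel of the forms.
  obtain ⟨r0, hr0⟩ := T.rangeRestrict.exists_rightInverse_of_surjective T.range_rangeRestrict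
  obtain ⟨r, hr⟩ := LinearMap.exists_extend r0
  refine ⟨A, r, fun j z => ?_⟩
  have h1 : T (r (T z)) = T z := by
    have e1 : r (T z) = r0 (T.rangeRestrict z) := by
      rw [← hr]; rfl
    have e2 := congrArg Subtype.val (LinearMap.congr_fun hr0 (T.rangeRestrict z))
    rw [e1]; exact e2
  have hj : ℓ j ∈ Submodule.span ℝ (s' : Set (E →ₗ[ℝ] ℝ)) := by
    rw [← hspan]; exact Submodule.subset_span ⟨j, rfl⟩
  change ℓ j (r (T z)) = ℓ j z
  generalize ℓ j = f at hj
  induction hj using Submodule.span_induction with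
  | mem f hf =>
    rw [← hA, Finset.coe_image] at hf
    obtain ⟨α, hα, rfl⟩ := hf
    exact congrFun h1 ⟨α, hα⟩
  | zero => rfl
  | add f g _ _ hf hg => rw [LinearMap.add_apply, LinearMap.add_apply, hf, hg]
  | smul c f _ hf => rw [LinearMap.smul_apply, LinearMap.smul_apply, hf]

section reduction

open NC

variable {N d : ℕ} {V : Fin (d + 1) → Euc N → Euc N}

/-- Lie series without terms of weight greater than `m`. -/
def lieTr (d m : ℕ) : Submodule ℝ (NC d) := lieSer d ⊓ poly d m

instance (m : ℕ) : FiniteDimensional ℝ (lieTr d m) := by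
  set T : lieTr d m →ₗ[ℝ] (wordsLE d m → ℝ) :=
    LinearMap.pi fun w : wordsLE d m => (coef w.1).comp (lieTr d m).subtype with hT
  refine Module.Finite.of_injective T ?_
  rw [injective_iff_map_eq_zero]
  intro P hP
  ext w
  by_cases hw : weight w ≤ m
  · exact congrFun hP ⟨w, mem_wordsLE.mpr hw⟩
  · exact P.2.2 w (by omega)

/-- The linear form `P ↦ Φ(P rescaled by t)(x)_i` on polynomials of weight at most `m`. -/
def fieldForm (V : Fin (d + 1) → Euc N → Euc N) (m : ℕ) (t : ℝ) (x : Euc N) (i : Fin N) :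
    NC d →ₗ[ℝ] ℝ :=
  ∑ w ∈ wordsLE d m, (t ^ weight w * wordOp V w id x i) • coef w

theorem fieldForm_apply {m : ℕ} (t : ℝ) (x : Euc N) (i : Fin N) (P : NC d) :
    fieldForm V m t x i P = ∑ w ∈ wordsLE d m, t ^ weight w * wordOp V w id x i * coef w P := by
  simp [fieldForm, LinearMap.sum_apply]

theorem fieldForm_eq {m : ℕ} (t : ℝ) (x : Euc N) (i : Fin N) {P : NC d} (hP : P ∈ poly d m) :
    fieldForm V m t x i P = phiField V (rs t P) x i := by
  have e : phiField V (rs t P) = fun x => ∑ w ∈ wordsLE d m, coef w (rs t P) • wordOp V w id x :=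
    phiOp_eq_sum (rs_mem_poly hP t) id
  rw [e, fieldForm_apply]
  simp only [WithLp.ofLp_sum, Finset.sum_apply, PiLp.smul_apply, smul_eq_mul, coef_rs]
  exact Finset.sum_congr rfl fun w _ => by ring

/-- A Lie polynomial may be replaced by one that defines the same vector fields and whose
coefficients are controlled by finitely many values of these fields. -/
theorem exists_bounded_representative (V : Fin (d + 1) → Euc N → Euc N) (m : ℕ) :
    ∃ (A : Finset ({t : ℝ // 0 < t ∧ t ≤ 1} × Euc N × Fin N)) (ρ : NC d → NC d) (B : ℝ), 0 ≤ B ∧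
      ∀ P ∈ lieTr d m, ρ P ∈ lieTr d m ∧
        (∀ t : ℝ, 0 < t → t ≤ 1 → phiField V (rs t (ρ P)) = phiField V (rs t P)) ∧
        ∀ w, |coef w (ρ P)| ≤ B * ∑ α ∈ A, |fieldForm V m α.1 α.2.1 α.2.2 P| := by
  classical
  -- The forms for all `t`, `x` and `i` are taken together, so the reconstructed polynomial has the
  -- right field for every `t`, while `A` depends only on `V` and `m`.
  obtain ⟨A, r, hr⟩ := exists_finset_linear_reconstruction
    (fun α : {t : ℝ // 0 < t ∧ t ≤ 1} × Euc N × Fin N =>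
      (fieldForm V m α.1 α.2.1 α.2.2).comp (lieTr d m).subtype)
  set e : A → NC d := fun α => (r (Pi.single α 1) : NC d) with he
  set B := ∑ α, ∑ w ∈ wordsLE d m, |coef w (e α)| with hB
  refine ⟨A, fun P => r fun α => fieldForm V m α.1.1 α.1.2.1 α.1.2.2 P, B,
    Finset.sum_nonneg fun _ _ => Finset.sum_nonneg fun _ _ => abs_nonneg _, fun P hP => ?_⟩
  set Q := r fun α => fieldForm V m α.1.1 α.1.2.1 α.1.2.2 P with hQ
  refine ⟨Q.2, fun t ht0 ht1 => ?_, fun w => ?_⟩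
  · funext x
    ext i
    rw [← fieldForm_eq t x i Q.2.2, ← fieldForm_eq t x i hP.2]
    exact hr (⟨t, ht0, ht1⟩, x, i) ⟨P, hP⟩
  · have h1 : (Q : NC d) = ∑ α : A, fieldForm V m α.1.1 α.1.2.1 α.1.2.2 P • e α := by
      rw [hQ, LinearMap.pi_apply_eq_sum_univ r]
      simp only [he, Submodule.coe_sum, Submodule.coe_smul]
      refine Finset.sum_congr rfl fun α _ => ?_
      congr 3
      funext j
      simp [Pi.single_apply, eq_comm]
    have h2 : ∀ α w, |coef w (e α)| ≤ B := by
      intro α w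
      by_cases hw : weight w ≤ m
      · refine (Finset.single_le_sum (f := fun w => |coef w (e α)|) (fun _ _ => abs_nonneg _)
          (mem_wordsLE.mpr hw)).trans ?_
        exact Finset.single_le_sum (f := fun α => ∑ w ∈ wordsLE d m, |coef w (e α)|)
          (fun _ _ => Finset.sum_nonneg fun _ _ => abs_nonneg _) (Finset.mem_univ α)
      · have : coef w (e α) = 0 := (r (Pi.single α 1)).2.2 w (by omega)
        rw [this, abs_zero]
        exact Finset.sum_nonneg fun _ _ => Finset.sum_nonneg fun _ _ => abs_nonneg _
    change |coef w (Q : NC d)| ≤ _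
    rw [h1, map_sum, ← Finset.sum_coe_sort A, Finset.mul_sum]
    refine (Finset.abs_sum_le_sum_abs _ _).trans (Finset.sum_le_sum fun α _ => ?_)
    rw [map_smul, smul_eq_mul, abs_mul, mul_comm]
    exact mul_le_mul_of_nonneg_right (h2 α w) (abs_nonneg _)

/-! ### Series that act trivially -/

/-- The series all of whose components act as the zero operator. -/
def nullSer (V : Fin (d + 1) → Euc N → Euc N) : Submodule ℝ (NC d) where
  carrier := {P | ∀ k (f : Euc N → Euc N), Smooth f → phiOp V (cp k P) f = 0}
  add_mem' hP hQ k f hf := by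
    rw [map_add, phiOp_add (cp_mem_poly _ _) (cp_mem_poly _ _), hP k f hf, hQ k f hf, add_zero]
  zero_mem' k f _ := by rw [map_zero, phiOp_zero]
  smul_mem' c P hP k f hf := by
    rw [map_smul, phiOp_smul (cp_mem_poly _ _), hP k f hf, smul_zero]

theorem phiOp_apply_zero (hV : ∀ i, Smooth (V i)) {n : ℕ} {P : NC d} (hP : P ∈ poly d n) :
    phiOp V P (0 : Euc N → Euc N) = 0 := by
  rw [phiOp_eq_sum hP]
  funext x
  refine Finset.sum_eq_zero fun w _ => ?_
  -- The zero map is an empty linear combination, so linearity gives the claim.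
  have := congrFun (wordOp_sum_smul hV w (∅ : Finset ℕ) (fun _ => 0) (F := fun _ => id) (by simp)) x
  simp only [Finset.sum_empty] at this
  rw [show (0 : Euc N → Euc N) = fun _ => 0 from rfl, this, smul_zero]

/-- This is why `nullSer` tests against all smooth maps and not just the identity: here `P` acts on
what `Q` has produced. -/
theorem mul_mem_nullSer_right (hV : ∀ i, Smooth (V i)) {P : NC d} (hP : P ∈ nullSer V) (Q : NC d) :
    P * Q ∈ nullSer V := by
  intro k f hf
  rw [cp_mul, phiOp_sum (n := k)]
  · refine Finset.sum_eq_zero fun p _ => ?_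
    rw [phiOp_mul hV (cp_mem_poly _ _) (cp_mem_poly _ _) hf]
    exact hP _ _ (Smooth.phiOp hV (cp_mem_poly _ _) hf)
  · intro p hp
    rw [← Finset.HasAntidiagonal.mem_antidiagonal.mp hp]
    exact mul_mem_poly (cp_mem_poly _ _) (cp_mem_poly _ _)

theorem mul_mem_nullSer_left (hV : ∀ i, Smooth (V i)) (P : NC d) {Q : NC d} (hQ : Q ∈ nullSer V) :
    P * Q ∈ nullSer V := by
  intro k f hf
  rw [cp_mul, phiOp_sum (n := k)]
  · refine Finset.sum_eq_zero fun p _ => ?_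
    rw [phiOp_mul hV (cp_mem_poly _ _) (cp_mem_poly _ _) hf, hQ _ _ hf,
      phiOp_apply_zero hV (cp_mem_poly _ _)]
  · intro p hp
    rw [← Finset.HasAntidiagonal.mem_antidiagonal.mp hp]
    exact mul_mem_poly (cp_mem_poly _ _) (cp_mem_poly _ _)

theorem mul_sub_mul_mem_nullSer (hV : ∀ i, Smooth (V i)) {P P' Q Q' : NC d}
    (h : P - P' ∈ nullSer V) (h' : Q - Q' ∈ nullSer V) : P * Q - P' * Q' ∈ nullSer V := by
  have : P * Q - P' * Q' = (P - P') * Q + P' * (Q - Q') := by noncomm_ring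
  rw [this]
  exact Submodule.add_mem _ (mul_mem_nullSer_right hV h _) (mul_mem_nullSer_left hV _ h')

theorem pow_sub_pow_mem_nullSer (hV : ∀ i, Smooth (V i)) {P P' : NC d} (h : P - P' ∈ nullSer V)
    (k : ℕ) : P ^ k - P' ^ k ∈ nullSer V := by
  induction k with
  | zero => simp
  | succ k ih => rw [pow_succ, pow_succ]; exact mul_sub_mul_mem_nullSer hV ih h

/-- The condition is imposed on each component separately, so the ideal is closed for the weight
filtration; this lets infinite series such as exp and log pass. -/
theorem mem_nullSer_of_approx {P : NC d} (h : ∀ n, ∃ Q ∈ nullSer V, P - Q ∈ fil d (n + 1)) :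
    P ∈ nullSer V := by
  intro k f hf
  obtain ⟨Q, hQ, hPQ⟩ := h k
  rw [cp_eq_of_sub_mem (Nat.lt_succ_self k) hPQ]
  exact hQ k f hf

theorem sub_sub_sub_mem_fil {n : ℕ} {P P' Q Q' : NC d} (h : P - Q ∈ fil d n)
    (h' : P' - Q' ∈ fil d n) : (P - P') - (Q - Q') ∈ fil d n := by
  convert Submodule.sub_mem _ h h' using 1
  abel

theorem ex_sub_ex_mem_nullSer (hV : ∀ i, Smooth (V i)) {P P' : NC d} (hP : P ∈ fil d 1)
    (hP' : P' ∈ fil d 1) (h : P - P' ∈ nullSer V) : ex P - ex P' ∈ nullSer V := by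
  refine mem_nullSer_of_approx fun n => ⟨_, ?_,
    sub_sub_sub_mem_fil (ex_sub_mem_fil hP (n + 1)) (ex_sub_mem_fil hP' (n + 1))⟩
  rw [← Finset.sum_sub_distrib]
  refine Submodule.sum_mem _ fun k _ => ?_
  rw [← smul_sub]
  exact Submodule.smul_mem _ _ (pow_sub_pow_mem_nullSer hV h k)

theorem lg_sub_lg_mem_nullSer (hV : ∀ i, Smooth (V i)) {Q Q' : NC d} (hQ : Q - 1 ∈ fil d 1)
    (hQ' : Q' - 1 ∈ fil d 1) (h : Q - Q' ∈ nullSer V) : lg Q - lg Q' ∈ nullSer V := by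
  refine mem_nullSer_of_approx fun n => ⟨_, ?_,
    sub_sub_sub_mem_fil (lg_sub_mem_fil hQ n) (lg_sub_mem_fil hQ' n)⟩
  rw [← Finset.sum_sub_distrib]
  refine Submodule.sum_mem _ fun k _ => ?_
  rw [← smul_sub]
  exact Submodule.smul_mem _ _ (pow_sub_pow_mem_nullSer hV (by simpa using h) _)

theorem expProd_sub_mem_nullSer (hV : ∀ i, Smooth (V i)) {ι : Type*} {z z' : ι → NC d}
    (hz : ∀ i, z i ∈ fil d 1) (hz' : ∀ i, z' i ∈ fil d 1) (h : ∀ i, z i - z' i ∈ nullSer V)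
    (l : List ι) : expProd (l.map z) - expProd (l.map z') ∈ nullSer V := by
  induction l with
  | nil => simp
  | cons i l ih =>
    have e : ∀ y : ι → NC d, expProd ((i :: l).map y) = ex (y i) * expProd (l.map y) := by
      intro y; simp [expProd]
    rw [e, e]
    exact mul_sub_mul_mem_nullSer hV (ex_sub_ex_mem_nullSer hV (hz i) (hz' i) (h i)) ih

theorem phiField_rs_eq_sum {m : ℕ} {P : NC d} (hP : P ∈ poly d m) (t : ℝ) :
    phiField V (rs t P) = ∑ k ∈ Finset.range (m + 1), t ^ k • phiField V (cp k P) := by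
  have h1 : rs t P = ∑ k ∈ Finset.range (m + 1), t ^ k • cp k P := by
    rw [← sum_cp (rs_mem_poly hP t)]
    simp only [cp_rs]
  rw [h1]
  have h2 : ∀ k ∈ Finset.range (m + 1), cp k P ∈ poly d m := fun k hk =>
    poly_mono (by have := Finset.mem_range.mp hk; omega) (cp_mem_poly k P)
  refine (phiOp_sum _ (fun k hk => Submodule.smul_mem _ _ (h2 k hk)) id).trans ?_
  exact Finset.sum_congr rfl fun k hk => phiOp_smul (h2 k hk) _ _

theorem phiField_rs_tr_eq_of_sub_mem_nullSer {P P' : NC d} (h : P - P' ∈ nullSer V) (m : ℕ)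
    (t : ℝ) : phiField V (rs t (tr m P)) = phiField V (rs t (tr m P')) := by
  rw [phiField_rs_eq_sum (tr_mem_poly m P), phiField_rs_eq_sum (tr_mem_poly m P')]
  refine Finset.sum_congr rfl fun k hk => ?_
  have hk' : k ≤ m := by have := Finset.mem_range.mp hk; omega
  rw [cp_tr, if_pos hk', cp_tr, if_pos hk']
  congr 1
  have h1 := h k id contDiff_id
  rw [map_sub, phiOp_sub (cp_mem_poly _ _) (cp_mem_poly _ _), sub_eq_zero] at h1
  exact h1

/-- The rescaled fields are polynomials in `t` whose coefficients are the fields of the components;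
agreement on the infinite set `(0, 1]` separates these. For Lie components, equal fields mean equal
operators on all smooth maps. -/
theorem sub_mem_nullSer_of_phiField_eq (hV : ∀ i, Smooth (V i)) {m : ℕ} {P P' : NC d}
    (hP : P ∈ lieTr d m) (hP' : P' ∈ lieTr d m)
    (h : ∀ t : ℝ, 0 < t → t ≤ 1 → phiField V (rs t P) = phiField V (rs t P')) :
    P - P' ∈ nullSer V := by
  have key : ∀ k x i, k ≤ m → phiField V (cp k P) x i = phiField V (cp k P') x i := by
    intro k x i hk
    set p : Polynomial ℝ := ∑ j ∈ Finset.range (m + 1), Polynomial.C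
      (phiField V (cp j P) x i - phiField V (cp j P') x i) * Polynomial.X ^ j with hp
    have hp0 : p = 0 := by
      refine Polynomial.eq_zero_of_infinite_isRoot p ((Set.Ioc_infinite zero_lt_one).mono ?_)
      intro t ht
      have h1 := congrArg (fun y : Euc N => y i) (congrFun (h t ht.1 ht.2) x)
      rw [phiField_rs_eq_sum hP.2, phiField_rs_eq_sum hP'.2] at h1
      simp only [Finset.sum_apply, Pi.smul_apply, WithLp.ofLp_sum, PiLp.smul_apply,
        smul_eq_mul] at h1
      change Polynomial.eval t p = 0
      rw [hp, Polynomial.eval_finsetSum]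
      simp only [Polynomial.eval_mul, Polynomial.eval_C, Polynomial.eval_pow, Polynomial.eval_X]
      rw [← sub_eq_zero, ← Finset.sum_sub_distrib] at h1
      rw [← h1]
      exact Finset.sum_congr rfl fun j _ => by ring
    have h2 := congrArg (fun q => Polynomial.coeff q k) hp0
    simp only [hp, Polynomial.finsetSum_coeff, Polynomial.coeff_C_mul_X_pow, Polynomial.coeff_zero,
      Finset.sum_ite_eq, Finset.mem_range] at h2
    rw [if_pos (by omega)] at h2
    exact sub_eq_zero.mp h2
  intro k f hf
  rw [map_sub, phiOp_sub (cp_mem_poly _ _) (cp_mem_poly _ _),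
    (liePoly_phiOp hV (hP.1 k)).2 f hf, (liePoly_phiOp hV (hP'.1 k)).2 f hf, sub_eq_zero]
  congr 1
  rcases le_or_gt k m with hk | hk
  · funext x
    ext i
    exact key k x i hk
  · have h0 : ∀ Q ∈ poly d m, cp k Q = 0 := by
      intro Q hQ
      rw [← tr_eq_self hQ, cp_tr, if_neg (by omega)]
    rw [h0 P hP.2, h0 P' hP'.2]

end reduction

/-! ### Exponential moments and the `L^p` bound -/

/-- The sum is at most `A.card` times its largest term. This replaces Hölder's inequality when
exponential moments are combined; the `1` covers the empty sum. -/
theorem exp_sum_le {ι : Type*} (A : Finset ι) (y : ι → ℝ) :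
    Real.exp (∑ α ∈ A, y α) ≤ 1 + ∑ α ∈ A, Real.exp (A.card * y α) := by
  rcases A.eq_empty_or_nonempty with rfl | hA
  · simp
  · obtain ⟨β, hβ, hmax⟩ := A.exists_max_image y hA
    have h1 : ∑ α ∈ A, y α ≤ A.card * y β := by
      simpa using Finset.sum_le_sum hmax
    have h2 : Real.exp (A.card * y β) ≤ ∑ α ∈ A, Real.exp (A.card * y α) :=
      Finset.single_le_sum (f := fun α => Real.exp (A.card * y α))
        (fun _ _ => (Real.exp_pos _).le) hβ
    linarith [Real.exp_le_exp.mpr h1]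

theorem integrable_exp_of_le_sum {Ω ι : Type*} [MeasurableSpace Ω] {μ : Measure Ω}
    [IsFiniteMeasure μ] (A : Finset ι) {R : Ω → ℝ} (hR : Measurable R) {Y : ι → Ω → ℝ}
    (hle : ∀ ω, R ω ≤ ∑ α ∈ A, Y α ω)
    (hY : ∀ α ∈ A, ∀ a : ℝ, 0 < a → Integrable (fun ω => Real.exp (a * Y α ω)) μ)
    {a : ℝ} (ha : 0 ≤ a) : Integrable (fun ω => Real.exp (a * R ω)) μ := by
  rcases ha.eq_or_lt with rfl | ha
  · simp
  have hbig : Integrable (fun ω => 1 + ∑ α ∈ A, Real.exp (A.card * (a * Y α ω))) μ := by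
    refine (integrable_const _).add (integrable_finsetSum _ fun α hα => ?_)
    have hcard : 0 < (A.card : ℝ) := by exact_mod_cast Finset.card_pos.mpr ⟨α, hα⟩
    simpa only [mul_assoc] using hY α hα (A.card * a) (by positivity)
  refine hbig.mono' (by fun_prop) (ae_of_all _ fun ω => ?_)
  rw [Real.norm_eq_abs, abs_of_pos (Real.exp_pos _)]
  refine le_trans ?_ (exp_sum_le A fun α => a * Y α ω)
  rw [← Finset.mul_sum]
  exact Real.exp_le_exp.mpr (mul_le_mul_of_nonneg_left (hle ω) ha.le)

theorem outerLpNorm_le_of_forall_le {Ω : Type*} [MeasurableSpace Ω] {μ : Measure Ω}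
    {f : Ω → ℝ≥0∞} {h : Ω → ℝ} (hh : Measurable h) (hle : ∀ ω, f ω ≤ ‖h ω‖ₑ) (p : ℝ) :
    outerLpNorm f p μ ≤ eLpNorm h (ENNReal.ofReal p) μ := by
  refine iInf_le_of_le (fun ω => ‖h ω‖ₑ) (iInf_le_of_le hh.enorm (iInf_le_of_le hle ?_))
  exact (eLpNorm_enorm _).le

end

end KRK

/-! ### The main theorem -/

open KRK NC
theorem theorem1
    {Ω : Type*} [MeasurableSpace Ω] (μ : Measure Ω) [IsProbabilityMeasure μ]
    (N d m M : ℕ) (hm : 1 ≤ m) (hM : 2 ≤ M)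
    (V : Fin (d + 1) → EuclideanSpace ℝ (Fin N) → EuclideanSpace ℝ (Fin N))
    (hV : ∀ i, IsCbSmooth (V i))
    (Z : Fin M → Ω → Series d)
    (hZmeas : ∀ i, Measurable (Z i))
    (hZlie : ∀ i ω, IsLieSeries (Z i ω))
    (hZtrunc : ∀ i ω, Z i ω = trunc m (Z i ω))
    (hZint : ∀ i, Integrable (fun ω => l2Norm (trunc m (Z i ω))) μ)
    (hZexp : ∀ s : ℝ, 0 < s → s ≤ 1 → ∀ a : ℝ, 0 < a →
      Integrable (fun ω =>
        Real.exp (a * ∑ j, cNorm (m + 1) (phiField V (rescale s (Z j ω))))) μ)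
    (p : ℝ) (hp : 1 ≤ p)
    (g : Fin M → (EuclideanSpace ℝ (Fin N) → EuclideanSpace ℝ (Fin N)) →
      EuclideanSpace ℝ (Fin N) → EuclideanSpace ℝ (Fin N))
    (hg : ∀ i, IsIntegrationScheme m (g i)) :
    ∃ C : ℝ, 0 < C ∧ ∀ s : ℝ, 0 < s → s ≤ 1 →
      outerLpNorm
        (fun ω => ⨆ x : EuclideanSpace ℝ (Fin N),
          ‖compAll (fun i => g i (phiField V (rescale s (Z i ω)))) x
            - flowExp (phiField V (rescale s
                (trunc m (bch (List.ofFn fun i => Z i ω).reverse)))) x‖ₑ)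
        p μ
      ≤ ENNReal.ofReal (C * s ^ (((m : ℝ) + 1) / 2)) := by
  have hVs : ∀ i, Smooth (V i) := fun i => (hV i).1
  obtain ⟨A, ρ, B, hB, hρ⟩ := exists_bounded_representative V m
  obtain ⟨C, c, hC, hc, hest⟩ := exists_scheme_error_le hV m M hg
  obtain ⟨K, hK, hcN⟩ := exists_cNorm_phiField_le hV m (m + 1)
  have hS : ∀ i ω, NC.mk (Z i ω) ∈ lieTr d m := by
    intro i ω
    refine ⟨isLieSeries_iff.mp (hZlie i ω), ?_⟩
    have h : NC.mk (Z i ω) = tr m (NC.mk (Z i ω)) :=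
      (congrArg NC.mk (hZtrunc i ω)).trans (mk_trunc m _)
    rw [h]; exact tr_mem_poly m _
  -- A measurable bound, free of `s`, for the coefficients of all the representatives `ρ (Z i ω)`.
  set R : Ω → ℝ := fun ω =>
    B * ∑ i, ∑ α ∈ A, |fieldForm V m α.1 α.2.1 α.2.2 (NC.mk (Z i ω))| with hRdef
  have hR0 : ∀ ω, 0 ≤ R ω := fun ω =>
    mul_nonneg hB (Finset.sum_nonneg fun _ _ => Finset.sum_nonneg fun _ _ => abs_nonneg _)
  have hRmeas : Measurable R := by
    have hcoef : ∀ i w, Measurable fun ω => coef w (NC.mk (Z i ω)) := fun i w =>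
      (measurable_pi_apply w).comp (hZmeas i)
    simp only [hRdef, fieldForm_apply, ← Real.norm_eq_abs]
    refine Measurable.const_mul (Finset.measurable_fun_sum _ fun i _ =>
      Finset.measurable_fun_sum _ fun α _ => Measurable.norm
        (Finset.measurable_fun_sum _ fun w _ => (hcoef i w).const_mul _)) _
  -- Each form in `A` is a coordinate of a value of the field rescaled by some `t`, that is, by `s =
  -- t ^ 2`; the moments are thus used only at finitely many `s`.
  have hRle : ∀ ω, R ω ≤ ∑ α ∈ A,
      B * ∑ j, cNorm (m + 1) (phiField V (rescale ((α.1 : ℝ) ^ 2) (Z j ω))) := by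
    intro ω
    have hsum : R ω = B * ∑ α ∈ A, ∑ i, |fieldForm V m α.1 α.2.1 α.2.2 (NC.mk (Z i ω))| := by
      simp only [hRdef]; rw [Finset.sum_comm]
    rw [hsum, ← Finset.mul_sum]
    refine mul_le_mul_of_nonneg_left (Finset.sum_le_sum fun α _ => Finset.sum_le_sum fun j _ => ?_) hB
    have ht := α.1.2
    have e : phiField V (rescale ((α.1 : ℝ) ^ 2) (Z j ω))
        = phiField V (rs (α.1 : ℝ) (NC.mk (Z j ω))) := by
      have h := mk_rescale (sq_nonneg (α.1 : ℝ)) (NC.mk (Z j ω))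
      rw [Real.sqrt_sq ht.1.le] at h
      rw [← h]; rfl
    have hcb := (hcN α.1 0 (NC.mk (Z j ω)) ht.1.le ht.2 (hS j ω).2 (lieSer_le_fil (hS j ω).1)).1
    rw [e, fieldForm_eq _ _ _ (hS j ω).2, ← Real.norm_eq_abs]
    exact (PiLp.norm_apply_le _ _).trans (hcb.norm_le_cNorm (m + 1) _)
  have hRexp : ∀ a : ℝ, 0 ≤ a → Integrable (fun ω => Real.exp (a * R ω)) μ := by
    intro a ha
    refine integrable_exp_of_le_sum A hRmeas hRle (fun α _ b hb => ?_) ha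
    -- The moments are given for strictly positive factors only, so `B = 0` is treated apart.
    rcases hB.eq_or_lt with hB0 | hBpos
    · simp [← hB0]
    · have ht := α.1.2
      simpa only [mul_assoc] using hZexp ((α.1 : ℝ) ^ 2) (pow_pos ht.1 2)
        (pow_le_one₀ ht.1.le ht.2) (b * B) (by positivity)
  set h₀ : Ω → ℝ := fun ω => C * Real.exp (c * R ω) with hh₀
  have hh₀meas : Measurable h₀ := by fun_prop
  have hp0 : ENNReal.ofReal p ≠ 0 := by simp; linarith
  have hmem : MemLp h₀ (ENNReal.ofReal p) μ := by
    rw [← integrable_norm_rpow_iff hh₀meas.aestronglyMeasurable hp0 ENNReal.ofReal_ne_top,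
      ENNReal.toReal_ofReal (by linarith)]
    have e : (fun ω => ‖h₀ ω‖ ^ p) = fun ω => C ^ p * Real.exp ((p * c) * R ω) := by
      funext ω
      rw [hh₀, Real.norm_of_nonneg (by positivity), Real.mul_rpow hC (Real.exp_pos _).le,
        ← Real.exp_mul]
      congr 2; ring
    rw [e]
    exact (hRexp (p * c) (by positivity)).const_mul _
  refine ⟨(eLpNorm h₀ (ENNReal.ofReal p) μ).toReal + 1, by positivity, fun s hs0 hs1 => ?_⟩
  set t := √s with ht
  have ht0 : 0 < t := Real.sqrt_pos.mpr hs0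
  have ht1 : t ≤ 1 := Real.sqrt_le_one.mpr hs1
  have hts : s ^ (((m : ℝ) + 1) / 2) = t ^ (m + 1) := by
    rw [ht, Real.sqrt_eq_rpow, ← Real.rpow_natCast, ← Real.rpow_mul hs0.le]
    congr 1; push_cast; ring
  have hrs : ∀ P : NC d, phiField V (rescale s P) = phiField V (rs t P) := by
    intro P; rw [← mk_rescale hs0.le]; rfl
  have hpoint : ∀ ω x, ‖compAll (fun i => g i (phiField V (rescale s (Z i ω)))) x
      - flowExp (phiField V (rescale s
          (trunc m (bch (List.ofFn fun i => Z i ω).reverse)))) x‖ ≤ t ^ (m + 1) * h₀ ω := by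
    intro ω x
    set z : Fin M → NC d := fun i => NC.mk (Z i ω) with hz
    set z' : Fin M → NC d := fun i => ρ (z i) with hz'
    have hzS : ∀ i, z i ∈ lieTr d m := fun i => hS i ω
    -- The schemes see only the fields, which the representatives leave unchanged.
    have e1 : (fun i => g i (phiField V (rescale s (Z i ω))))
        = fun i => g i (phiField V (rs t (z' i))) := by
      funext i
      rw [(hρ (z i) (hzS i)).2.1 t ht0 ht1, ← hrs]; rfl
    have hnull : ∀ i, z i - z' i ∈ nullSer V := fun i =>
      sub_mem_nullSer_of_phiField_eq hVs (hzS i) (hρ _ (hzS i)).1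
        fun t h0 h1 => ((hρ _ (hzS i)).2.1 t h0 h1).symm
    have hfil : ∀ i, z i ∈ fil d 1 := fun i => lieSer_le_fil (hzS i).1
    have hfil' : ∀ i, z' i ∈ fil d 1 := fun i => lieSer_le_fil (hρ _ (hzS i)).1.1
    -- The target field is computed from the series themselves; that it too is unchanged rests on
    -- the ideal of null series.
    have e2 : phiField V (rescale s (trunc m (bch (List.ofFn fun i => Z i ω).reverse)))
        = phiField V (rs t (tr m (lg (expProd (List.ofFn z').reverse)))) := by
      have hl : ∀ y : Fin M → NC d, (List.ofFn y).reverse = (List.finRange M).reverse.map y := by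
        intro y; rw [List.ofFn_eq_map, List.map_reverse]
      have hb : NC.mk (bch (List.ofFn fun i => Z i ω).reverse)
          = lg (expProd (List.ofFn z).reverse) := by
        rw [bch_eq, List.map_reverse, List.map_ofFn]; rfl
      have hb2 : NC.mk (trunc m (bch (List.ofFn fun i => Z i ω).reverse))
          = tr m (lg (expProd (List.ofFn z).reverse)) := by
        rw [← hb]; exact mk_trunc m _
      refine (hrs (NC.mk (trunc m (bch (List.ofFn fun i => Z i ω).reverse)))).trans ?_
      rw [hb2, hl z, hl z']
      have h1 : ∀ y : Fin M → NC d, (∀ i, y i ∈ fil d 1) →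
          expProd ((List.finRange M).reverse.map y) - 1 ∈ fil d 1 := by
        intro y hy
        refine expProd_sub_one_mem_fil fun u hu => ?_
        obtain ⟨i, -, rfl⟩ := List.mem_map.mp hu
        exact hy i
      exact phiField_rs_tr_eq_of_sub_mem_nullSer (lg_sub_lg_mem_nullSer hVs (h1 z hfil)
        (h1 z' hfil') (expProd_sub_mem_nullSer hVs hfil hfil' hnull _)) m t
    rw [e1, e2]
    refine (hest t (R ω) z' ht0.le ht1 (hR0 ω) (fun i => ⟨(hρ _ (hzS i)).1.1, (hρ _ (hzS i)).1.2,
      fun w => ((hρ _ (hzS i)).2.2 w).trans ?_⟩) x).trans (le_of_eq (by rw [hh₀]; ring))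
    refine mul_le_mul_of_nonneg_left ?_ hB
    exact Finset.single_le_sum
      (f := fun i => ∑ α ∈ A, |fieldForm V m α.1 α.2.1 α.2.2 (NC.mk (Z i ω))|)
      (fun _ _ => Finset.sum_nonneg fun _ _ => abs_nonneg _) (Finset.mem_univ i)
  -- The measurable majorant is `t ^ (m + 1) • h₀`, with all dependence on `s` in the scalar.
  have hbound := outerLpNorm_le_of_forall_le (μ := μ) (p := p)
    (f := fun ω => ⨆ x : EuclideanSpace ℝ (Fin N),
      ‖compAll (fun i => g i (phiField V (rescale s (Z i ω)))) x
        - flowExp (phiField V (rescale s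
            (trunc m (bch (List.ofFn fun i => Z i ω).reverse)))) x‖ₑ)
    (h := (t ^ (m + 1)) • h₀) (hh₀meas.const_smul _) (fun ω => iSup_le fun x => by
      rw [enorm_le_iff_norm_le, Pi.smul_apply, smul_eq_mul,
        Real.norm_of_nonneg (mul_nonneg (by positivity) (by rw [hh₀]; positivity))]
      exact hpoint ω x)
  refine hbound.trans ?_
  rw [eLpNorm_const_smul, hts, mul_comm ((eLpNorm h₀ _ μ).toReal + 1),
    ENNReal.ofReal_mul (by positivity), Real.enorm_of_nonneg (by positivity)]
  gcongr
  rw [ENNReal.ofReal_add ENNReal.toReal_nonneg zero_le_one, ENNReal.ofReal_toReal hmem.2.ne]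
  exact le_self_add
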